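/- Let $\Bbbk$ be a field, and let $A$ and $B$ be commutative Noetherian $\Bbbk$-algebras such that $A\otimes_\Bbbk B$ is Noetherian. Let $I\subseteq A$ and $J\subseteq B$ be ideals, let $L$ be a finitely generated $A$-module and $N$ a finitely generated $B$-module, and regard $L\otimes_\Bbbk N$ as an $A\otimes_\Bbbk B$-module via $(a\otimes b)(x\otimes y)=ax\otimes by$. Let $\mathcal I=I\otimes_\Bbbk B+A\otimes_\Bbbk J$, an ideal of $A\otimes_\Bbbk B$. For a commutative Noetherian ring $R$, an ideal $\mathfrak a$ of $R$ and a finitely generated $R$-module $M$, let $H^i_{\mathfrak a}(M)=\varinjlim_n \operatorname{Ext}^i_R(R/\mathfrak a^n,M)$ denote the $i$-th local cohomology module, and put $\operatorname{grade}(\mathfrak a,M)=\inf\{i : H^i_{\mathfrak a}(M)\neq 0\}$ and $\operatorname{cd}(\mathfrak a,M)=\sup\{i : H^i_{\mathfrak a}(M)\neq 0\}$ (with $\inf\emptyset=+\infty$ and $\sup\emptyset=-\infty$). Say that $M$ is Cohen–Macaulay with respect to $\mathfrak a$ if either $M=\mathfrak a M$, or $M\neq\mathfrak a M$ and $\operatorname{grade}(\mathfrak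 a,M)=\operatorname{cd}(\mathfrak a,M)$. Assume $IL\neq L$ and $JN\neq N$. Then $L\otimes_\Bbbk N$ is Cohen–Macaulay with respect to $\mathcal I$ if and only if $L$ is Cohen–Macaulay with respect to $I$ and $N$ is Cohen–Macaulay with respect to $J$. -/

import Mathlib

open scoped TensorProduct

universe u

noncomputable section

section LocalCohomologyInvariants

variable {R : Type u} [CommRing R] (𝔞 : Ideal R) (M : Type u) [AddCommGroup M] [Module R M]

/-- The set of all `i` for which the local cohomology module `H^i_𝔞(M)` is nonzero. -/
def localCohomologySupport : Set ℕ :=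
  {i | ¬ CategoryTheory.Limits.IsZero ((localCohomology 𝔞 i).obj (ModuleCat.of R M))}

/-- The grade of `M` with respect to `𝔞`: the infimum of all `i` with `H^i_𝔞(M) ≠ 0`,
where `inf ∅ = +∞`. -/
def idealGrade : WithBot ℕ∞ :=
  ⨅ i ∈ localCohomologySupport 𝔞 M, ((i : ℕ∞) : WithBot ℕ∞)

/-- The cohomological dimension of `M` with respect to `𝔞`: the supremum of all `i` with
`H^i_𝔞(M) ≠ 0`, where `sup ∅ = -∞`. -/
def cohomologicalDim : WithBot ℕ∞ :=
  ⨆ i ∈ localCohomologySupport 𝔞 M, ((i : ℕ∞) : WithBot ℕ∞)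

/-- `M` is Cohen-Macaulay with respect to `𝔞`. -/
def IsCohenMacaulayWrt : Prop :=
  𝔞 • (⊤ : Submodule R M) = ⊤ ∨
    (𝔞 • (⊤ : Submodule R M) ≠ ⊤ ∧ idealGrade 𝔞 M = cohomologicalDim 𝔞 M)

end LocalCohomologyInvariants

section TensorModule

variable (k A B L N : Type u) [Field k]
  [CommRing A] [Algebra k A] [CommRing B] [Algebra k B]
  [AddCommGroup L] [Module k L] [Module A L] [IsScalarTower k A L]
  [AddCommGroup N] [Module k N] [Module B N] [IsScalarTower k B N]

/-- The action of `A ⊗ B` on `L ⊗ N`, as a homomorphism of `k`-algebras: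
`a ⊗ b` acts as the tensor product of multiplication by `a` and multiplication by `b`. -/
def tensorAction : A ⊗[k] B →ₐ[k] Module.End k (L ⊗[k] N) :=
  Module.endTensorEndAlgHom.comp
    (Algebra.TensorProduct.map (Algebra.lsmul k k L : A →ₐ[k] Module.End k L)
      (Algebra.lsmul k k N : B →ₐ[k] Module.End k N))

/-- The `A ⊗ B`-module structure on `L ⊗ N`, with `(a ⊗ b) • (x ⊗ y) = (a • x) ⊗ (b • y)`. -/
@[reducible] def tensorModule : Module (A ⊗[k] B) (L ⊗[k] N) :=
  Module.compHom (L ⊗[k] N) (tensorAction k A B L N).toRingHom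

theorem tensorModule_tmul_smul_tmul (a : A) (b : B) (x : L) (y : N) :
    letI := tensorModule k A B L N
    (a ⊗ₜ[k] b) • (x ⊗ₜ[k] y) = (a • x) ⊗ₜ[k] (b • y) := rfl

variable {k A B} in
/-- The ideal `I ⊗ B + A ⊗ J` of `A ⊗ B`: the sum of the extensions of `I` and of `J`. -/
def tensorSumIdeal (I : Ideal A) (J : Ideal B) : Ideal (A ⊗[k] B) :=
  I.map (Algebra.TensorProduct.includeLeft : A →ₐ[k] A ⊗[k] B) +
    J.map (Algebra.TensorProduct.includeRight : B →ₐ[k] A ⊗[k] B)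

end TensorModule

end

/-!
The ideal `𝓘 = I ⊗ B + A ⊗ J` satisfies a Künneth formula for local cohomology,
`H^n_𝓘(L ⊗ N) = ⨁_{i + j = n} H^i_I(L) ⊗ H^j_J(N)`. Over a field a tensor product of nonzero
spaces is nonzero, so the set of degrees in which the local cohomology of `L ⊗ N` is nonzero is the
Minkowski sum of the corresponding sets for `L` and `N` (`localCohomologySupport_extTensor`).
For a module `M ≠ 𝔞 M`, being Cohen-Macaulay with respect to `𝔞` means that this set of degrees is a
singleton: an empty set has infimum `+∞` and supremum `-∞`. A sum of two subsets of `ℕ` is a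
singleton exactly when both summands are, and `𝓘 (L ⊗ N) ≠ L ⊗ N` because `L ⊗ N` surjects onto
`L / I L ⊗ N / J N ≠ 0`.

The Künneth formula is not needed for the limits themselves, only at each finite stage. Nonvanishing
of `H^i_𝔞(M)` says that some class in some `Ext^i(R / 𝔞^s, M)` has nonzero images in all the later
`Ext^i(R / 𝔞^t, M)` (`mem_localCohomologySupport_iff`), and this depends on the powers of `𝔞` only
up to cofinality (`HasSurvivingClass.of_cofinal`). The powers of `𝓘` are cofinal with the
ideals `I^s ⊗ B + A ⊗ J^s`, whose quotient rings are `A / I^s ⊗ B / J^s`. For finitely generated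
`X` and `Y` the external product is an isomorphism from `⨁_{i + j = n} Ext^i(X, L) ⊗ Ext^j(Y, N)`
to `Ext^n(X ⊗ Y, L ⊗ N)`, natural in `X` and `Y` (`kunnethSum_injective`, `kunnethSum_surjective`,
`kunnethSum_map`). Hence a product of surviving classes survives, and if in every bidegree `(i, j)`
with `i + j = n` one of the two factors has no surviving class, then neither does the tensor product
in degree `n`.

The external product of `α` and `β` is the Yoneda composite of `α ⊗ Y` with `L ⊗ β`, where `- ⊗ Y`
and `L ⊗ -` are exact functors. That it is an isomorphism follows by dimension shifting. For finite
free `X` and `Y` in degree zero it is a computation with bases. For `X` finite free, shifting along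
a presentation of `Y` gives all degrees (`extProductMap_bijective_of_free`); shifting along a
presentation of `X` then gives the general case: precomposition with a class in `Ext(X', X)`
commutes with the external product without a sign, and so with the whole sum over `i + j = n`.
-/

noncomputable section

/-! ### Naturality of the action of exact functors on `Ext` -/

section MapExactFunctorNaturality

open CategoryTheory CategoryTheory.Limits CategoryTheory.Abelian

universe v v' u₁ u₂ w w'

variable {C : Type u₁} [Category.{v} C] [Abelian C] [EnoughProjectives C] [HasExt.{w} C]
  {D : Type u₂} [Category.{v'} D] [Abelian D] [HasExt.{w'} D]

/-- A natural transformation between exact functors is compatible with their actions on `Ext`.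
Dimension shifting reduces the claim to degree zero. -/
theorem Ext_mapExactFunctor_naturality {F G : C ⥤ D} [F.Additive] [PreservesFiniteLimits F]
    [PreservesFiniteColimits F] [G.Additive] [PreservesFiniteLimits G]
    [PreservesFiniteColimits G] (τ : F ⟶ G) {X Y : C} {n : ℕ} (α : Abelian.Ext X Y n) :
    (α.mapExactFunctor F).comp (Ext.mk₀ (τ.app Y)) (add_zero n) =
      (Ext.mk₀ (τ.app X)).comp (α.mapExactFunctor G) (zero_add n) := by
  induction n generalizing X with
  | zero =>
    obtain ⟨f, rfl⟩ := (Ext.mk₀_bijective X Y).2 α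
    simp [Ext.mapExactFunctor_mk₀]
  | succ n ih =>
    let S := ShortComplex.mk _ _ (kernel.condition (Projective.π X))
    have hS : S.ShortExact :=
      { exact := ShortComplex.exact_of_f_is_kernel _ (kernelIsKernel S.g) }
    obtain ⟨β, rfl⟩ := Ext.contravariant_sequence_exact₃ hS Y α
      (Ext.eq_zero_of_projective _) (add_comm 1 n)
    rw [Ext.mapExactFunctor_comp, Ext.mapExactFunctor_comp, Ext.comp_assoc_of_third_deg_zero, ih,
      ← Ext.comp_assoc_of_second_deg_zero, Ext.mapExactFunctor_extClass,
      Ext.mapExactFunctor_extClass]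
    have h := ShortComplex.ShortExact.extClass_naturality (hS.map_of_exact F)
      (hS.map_of_exact G) (S.mapNatTrans τ)
    exact (congrArg (fun z => z.comp (β.mapExactFunctor G) (add_comm 1 n)) h).trans
      (Ext.comp_assoc (Ext.mk₀ (τ.app X)) (hS.map_of_exact G).extClass (β.mapExactFunctor G)
        (zero_add 1) (add_comm 1 n) (by lia))

end MapExactFunctorNaturality

/-! ### Comparison of the two definitions of `Ext` -/

section ExtComparison

open CategoryTheory CategoryTheory.Limits CategoryTheory.Abelian Opposite

universe v u₁

variable {R : Type v} [CommRing R] {C : Type u₁} [Category.{v} C] [Abelian C] [Linear R C]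
  [EnoughProjectives C]

namespace CategoryTheory.ProjectiveResolution

variable {X Y : C} (P : ProjectiveResolution X)

variable {P} in
/-- The map of complexes `Hom(P, Y) ⟶ Hom(P', Y)` induced by a map `P' ⟶ P` of projective
resolutions. -/
def linearYonedaMap {X' : C} {P' : ProjectiveResolution X'} {g : X' ⟶ X} (φ : Hom P' P g) (Y : C) :
    P.complex.linearYonedaObj R Y ⟶ P'.complex.linearYonedaObj R Y :=
  (HomologicalComplex.unopFunctor _ _).map
    ((((linearYoneda R C).obj Y).rightOp.mapHomologicalComplex _).map φ.hom).op

variable {P} in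
/-- The computation of the derived functor `Ext` by a projective resolution is natural in the
resolution. -/
theorem isoExt_inv_naturality {X' : C} {P' : ProjectiveResolution X'} {g : X' ⟶ X}
    (φ : Hom P' P g) (Y : C) (n : ℕ) :
    (P.isoExt n Y).inv ≫ ((Ext R C n).map g.op).app Y =
      HomologicalComplex.homologyMap (linearYonedaMap (R := R) φ Y) n ≫ (P'.isoExt n Y).inv := by
  have h1 := congrArg Quiver.Hom.unop (isoLeftDerivedObj_hom_naturality g P' P φ.hom
    (by simpa using φ.hom_f_zero_comp_π_f_zero) ((linearYoneda R C).obj Y).rightOp n)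
  have h2 := congrArg Quiver.Hom.unop (HomologicalComplex.homologyOp_hom_naturality
    (linearYonedaMap (R := R) φ Y) n)
  have e1 : (P.isoExt n Y).inv = ((P.complex.linearYonedaObj R Y).homologyOp n).hom.unop ≫
    (P.isoLeftDerivedObj ((linearYoneda R C).obj Y).rightOp n).hom.unop := rfl
  have e2 : (P'.isoExt n Y).inv = ((P'.complex.linearYonedaObj R Y).homologyOp n).hom.unop ≫
    (P'.isoLeftDerivedObj ((linearYoneda R C).obj Y).rightOp n).hom.unop := rfl
  rw [e1, e2]
  refine (Category.assoc _ _ _).trans (Eq.trans ?_ (Category.assoc _ _ _))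
  refine (congrArg
    (fun z => ((P.complex.linearYonedaObj R Y).homologyOp n).hom.unop ≫ z) h1).trans ?_
  refine Eq.trans ?_ (congrArg (fun z => z ≫
    (P'.isoLeftDerivedObj ((linearYoneda R C).obj Y).rightOp n).hom.unop) h2)
  exact (Category.assoc _ _ _).symm

/-- A cocycle `P_n ⟶ Y`, as an element of the kernel of the differential of `Hom(P, Y)`. -/
def linearYonedaCycle {n : ℕ} (f : P.complex.X n ⟶ Y) (hf : P.complex.d (n + 1) n ≫ f = 0) :
    LinearMap.ker ((P.complex.linearYonedaObj R Y).sc n).g.hom :=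
  ⟨f, by
    have : (ComplexShape.up ℕ).next n = n + 1 := by simp
    change (P.complex.linearYonedaObj R Y).d n ((ComplexShape.up ℕ).next n) f = 0
    rw [this]
    exact hf⟩

/-- The class of a cocycle `P_n ⟶ Y` in the derived functor `Ext R C n`, which is the `Ext` that
occurs in `localCohomology`. -/
def cocycleClass {n : ℕ} (f : P.complex.X n ⟶ Y) (hf : P.complex.d (n + 1) n ≫ f = 0) :
    ((Ext R C n).obj (op X)).obj Y :=
  (P.isoExt n Y).inv (((P.complex.linearYonedaObj R Y).homologyπ n)
    (((P.complex.linearYonedaObj R Y).sc n).moduleCatCyclesIso.inv (P.linearYonedaCycle f hf)))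

theorem cocycleClass_surjective {n : ℕ} (z : ((Ext R C n).obj (op X)).obj Y) :
    ∃ (f : P.complex.X n ⟶ Y) (hf : P.complex.d (n + 1) n ≫ f = 0),
      P.cocycleClass f hf = z := by
  obtain ⟨y, rfl⟩ := (ModuleCat.epi_iff_surjective (P.isoExt n Y).inv).1 inferInstance z
  obtain ⟨y, rfl⟩ := (ModuleCat.epi_iff_surjective
    ((P.complex.linearYonedaObj R Y).homologyπ n)).1 inferInstance y
  obtain ⟨⟨f, hf⟩, rfl⟩ := (ModuleCat.epi_iff_surjective
    (((P.complex.linearYonedaObj R Y).sc n).moduleCatCyclesIso.inv)).1 inferInstance y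
  refine ⟨f, ?_, rfl⟩
  have : (ComplexShape.up ℕ).next n = n + 1 := by simp
  change (P.complex.linearYonedaObj R Y).d n ((ComplexShape.up ℕ).next n) f = 0 at hf
  rw [this] at hf
  exact hf

variable {P} in
theorem map_cocycleClass {X' : C} {P' : ProjectiveResolution X'} {g : X' ⟶ X}
    (φ : Hom P' P g) {n : ℕ} (f : P.complex.X n ⟶ Y) (hf : P.complex.d (n + 1) n ≫ f = 0) :
    ((Ext R C n).map g.op).app Y (P.cocycleClass f hf) =
      P'.cocycleClass (φ.hom.f n ≫ f) (by simp [← φ.hom.comm_assoc, hf]) := by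
  have h := congrArg (fun z => z.hom (((P.complex.linearYonedaObj R Y).homologyπ n)
    (((P.complex.linearYonedaObj R Y).sc n).moduleCatCyclesIso.inv (P.linearYonedaCycle f hf))))
    (isoExt_inv_naturality (R := R) φ Y n)
  refine h.trans ?_
  simp only [ModuleCat.hom_comp, LinearMap.comp_apply]
  unfold cocycleClass
  congr 1
  have h2 := congrArg (fun z => z.hom
    (((P.complex.linearYonedaObj R Y).sc n).moduleCatCyclesIso.inv (P.linearYonedaCycle f hf)))
    (HomologicalComplex.homologyπ_naturality (linearYonedaMap (R := R) φ Y) n)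
  refine h2.trans (congrArg
    (((P'.complex.linearYonedaObj R Y).homologyπ n).hom) ?_)
  apply (ModuleCat.mono_iff_injective ((P'.complex.linearYonedaObj R Y).iCycles n)).1 inferInstance
  have h3 := congrArg (fun z => z.hom
    (((P.complex.linearYonedaObj R Y).sc n).moduleCatCyclesIso.inv (P.linearYonedaCycle f hf)))
    (HomologicalComplex.cyclesMap_i (linearYonedaMap (R := R) φ Y) n)
  refine h3.trans ?_
  have e1 := ShortComplex.moduleCatCyclesIso_inv_iCycles_apply
    ((P.complex.linearYonedaObj R Y).sc n) (P.linearYonedaCycle f hf)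
  have e2 := ShortComplex.moduleCatCyclesIso_inv_iCycles_apply
    ((P'.complex.linearYonedaObj R Y).sc n) (P'.linearYonedaCycle (φ.hom.f n ≫ f)
      (by simp [← φ.hom.comm_assoc, hf]))
  refine Eq.trans ?_ e2.symm
  refine (congrArg (((linearYonedaMap (R := R) φ Y).f n).hom) e1).trans ?_
  rfl

/-- In degree zero `prev 0 = 0` and the differential `P.complex.d 0 0` is zero, so that the
condition on the right reads `f = 0`. -/
theorem cocycleClass_eq_zero_iff {n : ℕ} (f : P.complex.X n ⟶ Y)
    (hf : P.complex.d (n + 1) n ≫ f = 0) :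
    P.cocycleClass (R := R) f hf = 0 ↔
      ∃ g : (P.complex.X ((ComplexShape.up ℕ).prev n) ⟶ Y),
        P.complex.d n ((ComplexShape.up ℕ).prev n) ≫ g = f := by
  have h1 : P.cocycleClass (R := R) f hf = 0 ↔ ((P.complex.linearYonedaObj R Y).homologyπ n)
    (((P.complex.linearYonedaObj R Y).sc n).moduleCatCyclesIso.inv
      (P.linearYonedaCycle f hf)) = 0 :=
    map_eq_zero_iff (P.isoExt (R := R) n Y).inv.hom
      ((ModuleCat.mono_iff_injective (P.isoExt (R := R) n Y).inv).1 inferInstance)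
  rw [h1]
  have e1 : (P.complex.linearYonedaObj R Y).homologyπ n
      (((P.complex.linearYonedaObj R Y).sc n).moduleCatCyclesIso.inv
        (P.linearYonedaCycle (R := R) f hf)) =
      ((P.complex.linearYonedaObj R Y).sc n).moduleCatHomologyIso.inv
        (((P.complex.linearYonedaObj R Y).sc n).moduleCatLeftHomologyData.π
          (P.linearYonedaCycle (R := R) f hf)) :=
    congrArg (fun z => z.hom (P.linearYonedaCycle (R := R) f hf))
      (ShortComplex.moduleCatCyclesIso_inv_π ((P.complex.linearYonedaObj R Y).sc n))
  rw [e1]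
  have e2 : Function.Injective ((P.complex.linearYonedaObj R Y).sc n).moduleCatHomologyIso.inv :=
    (ModuleCat.mono_iff_injective _).1 inferInstance
  refine (map_eq_zero_iff _ e2).trans ?_
  refine (Submodule.Quotient.mk_eq_zero _).trans ?_
  constructor
  · rintro ⟨g, hg⟩
    exact ⟨g, congrArg Subtype.val hg⟩
  · rintro ⟨g, hg⟩
    exact ⟨g, Subtype.ext hg⟩

/-- A cocycle represents zero in the derived functor `Ext R C n` if and only if it represents zero
in `Abelian.Ext`, which carries Yoneda products and long exact sequences. -/
theorem cocycleClass_eq_zero_iff_extMk_eq_zero [HasExt.{v} C] {n : ℕ} (f : P.complex.X n ⟶ Y)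
    (hf : P.complex.d (n + 1) n ≫ f = 0) :
    P.cocycleClass (R := R) f hf = 0 ↔ P.extMk f (n + 1) rfl hf = 0 := by
  rw [cocycleClass_eq_zero_iff]
  cases n with
  | zero =>
    have e1 : (∃ g : (P.complex.X ((ComplexShape.up ℕ).prev 0) ⟶ Y),
        P.complex.d 0 ((ComplexShape.up ℕ).prev 0) ≫ g = f) ↔ f = 0 := by
      have : (ComplexShape.up ℕ).prev 0 = 0 := by simp
      rw [this]
      simp [eq_comm]
    rw [e1]
    constructor
    · rintro rfl
      simp
    · intro h
      rw [← P.extEquivCohomologyClass.apply_eq_iff_eq, extEquivCohomologyClass_extMk,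
        extEquivCohomologyClass_zero, CochainComplex.HomComplex.CohomologyClass.mk_eq_zero_iff,
        CochainComplex.HomComplex.Cocycle.toSingleMk_mem_coboundaries_iff _ _ _ _ _ 1
          (by lia)] at h
      obtain ⟨g, hg⟩ := h
      have hz : IsZero (P.cochainComplex.X 1) := P.cochainComplex.isZero_of_isStrictlyLE 0 1
      rw [hz.eq_of_src g 0, Limits.comp_zero] at hg
      rw [← cancel_epi (P.cochainComplexXIso (-(0 : ℕ)) 0 rfl).hom, ← hg, Limits.comp_zero]
  | succ n =>
    rw [P.extMk_eq_zero_iff f _ rfl hf n rfl]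
    have : (ComplexShape.up ℕ).prev (n + 1) = n := by simp
    rw [this]

end CategoryTheory.ProjectiveResolution
end ExtComparison

/-! ### Nonvanishing of local cohomology -/

section SurvivingClasses

open CategoryTheory CategoryTheory.Limits Opposite

variable {R : Type u} [CommRing R]

/-- The projection `R ⧸ K ⟶ R ⧸ K'` for ideals `K ≤ K'`. -/
abbrev quotientHom {K K' : Ideal R} (h : K ≤ K') :
    ModuleCat.of R (R ⧸ K) ⟶ ModuleCat.of R (R ⧸ K') :=
  ModuleCat.ofHom (Submodule.mapQ K K' LinearMap.id h)

theorem quotientHom_comp {K K' K'' : Ideal R} (h : K ≤ K') (h' : K' ≤ K'') :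
    quotientHom h ≫ quotientHom h' = quotientHom (h.trans h') := by
  ext; rfl

/-- For a family of ideals `K`, some class in some `Ext^i(R ⧸ K s, M)` has nonzero restrictions
to all the `R ⧸ K t` with `K t ≤ K s`. For a decreasing family of ideals this says that the
direct limit of the modules `Ext^i(R ⧸ K s, M)` is nonzero. -/
def HasSurvivingClass (K : ℕ → Ideal R) (M : ModuleCat.{u} R) (i : ℕ) : Prop :=
  ∃ (s : ℕ) (x : Abelian.Ext (ModuleCat.of R (R ⧸ K s)) M i), ∀ (t : ℕ) (h : K t ≤ K s),
    (Abelian.Ext.mk₀ (quotientHom h)).comp x (zero_add i) ≠ 0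

/-- Surviving classes depend on the family of ideals only up to cofinality. -/
theorem HasSurvivingClass.of_cofinal {K K' : ℕ → Ideal R} {M : ModuleCat.{u} R} {i : ℕ}
    (h : HasSurvivingClass K M i) (h₁ : ∀ s, ∃ t, K' t ≤ K s) (h₂ : ∀ s, ∃ t, K t ≤ K' s) :
    HasSurvivingClass K' M i := by
  obtain ⟨s, x, hx⟩ := h
  obtain ⟨t, ht⟩ := h₁ s
  refine ⟨t, (Abelian.Ext.mk₀ (quotientHom ht)).comp x (zero_add i), fun t' ht' h0 => ?_⟩
  obtain ⟨r, hr⟩ := h₂ t'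
  refine hx r (hr.trans (ht'.trans ht)) ?_
  have := congrArg (fun z => (Abelian.Ext.mk₀ (quotientHom hr)).comp z (zero_add i)) h0
  simpa [Abelian.Ext.mk₀_comp_mk₀_assoc, quotientHom_comp] using this

/-- Local cohomology, a filtered colimit computed on underlying sets, vanishes if and only if every
class at a finite stage becomes zero at a later stage. -/
theorem isZero_localCohomology_iff (𝔞 : Ideal R) (i : ℕ) (M : ModuleCat.{u} R) :
    IsZero ((localCohomology 𝔞 i).obj M) ↔
      ∀ (s : ℕ) (x : ((Ext R (ModuleCat.{u} R) i).obj (op (ModuleCat.of R (R ⧸ 𝔞 ^ s)))).obj M),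
        ∃ (t : ℕ) (h : s ≤ t), ((Ext R (ModuleCat.{u} R) i).map
          (quotientHom (Ideal.pow_le_pow_right (I := 𝔞) h)).op).app M x = 0 := by
  let D := localCohomology.diagram (localCohomology.idealPowersDiagram 𝔞) i
  let D' := D ⋙ (evaluation (ModuleCat.{u} R) (ModuleCat.{u} R)).obj M
  have hc : IsColimit (((evaluation (ModuleCat.{u} R) (ModuleCat.{u} R)).obj M).mapCocone
      (colimit.cocone D)) := isColimitOfPreserves _ (colimit.isColimit D)
  have e : (((evaluation (ModuleCat.{u} R) (ModuleCat.{u} R)).obj M).mapCocone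
      (colimit.cocone D)).pt = (localCohomology 𝔞 i).obj M := rfl
  have : PreservesFilteredColimitsOfSize.{0, 0} (forget (ModuleCat.{u} R)) :=
    preservesFilteredColimitsOfSize_shrink.{0, u, 0, u} _
  have : PreservesColimit D' (forget (ModuleCat.{u} R)) := inferInstance
  rw [← e]
  constructor
  · intro hz s x
    have h0 : (((evaluation (ModuleCat.{u} R) (ModuleCat.{u} R)).obj M).mapCocone
      (colimit.cocone D)).ι.app (op (op s)) x =
        (((evaluation (ModuleCat.{u} R) (ModuleCat.{u} R)).obj M).mapCocone
      (colimit.cocone D)).ι.app (op (op s)) 0 := by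
      rw [hz.eq_of_tgt ((((evaluation (ModuleCat.{u} R) (ModuleCat.{u} R)).obj M).mapCocone
        (colimit.cocone D)).ι.app (op (op s))) 0]
      rfl
    obtain ⟨j, f, g, hfg⟩ := Concrete.isColimit_exists_of_rep_eq D' hc _ _ h0
    refine ⟨j.unop.unop, f.unop.unop.le, ?_⟩
    exact hfg.trans (map_zero _)
  · intro H
    rw [IsZero.iff_id_eq_zero]
    ext z
    obtain ⟨j, x, rfl⟩ := Concrete.isColimit_exists_rep D' hc z
    obtain ⟨t, h, ht⟩ := H j.unop.unop x
    let f : j ⟶ op (op t) := (homOfLE h).op.op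
    have := congrArg (fun q => q.hom x)
      ((((evaluation (ModuleCat.{u} R) (ModuleCat.{u} R)).obj M).mapCocone
        (colimit.cocone D)).w f)
    refine this.symm.trans ?_
    exact (congrArg ((((evaluation (ModuleCat.{u} R) (ModuleCat.{u} R)).obj M).mapCocone
        (colimit.cocone D)).ι.app (op (op t))).hom ht).trans (LinearMap.map_zero _)

theorem mem_localCohomologySupport_iff (𝔞 : Ideal R) (i : ℕ) (M : Type u) [AddCommGroup M]
    [Module R M] :
    i ∈ localCohomologySupport 𝔞 M ↔
      HasSurvivingClass (fun s => 𝔞 ^ s) (ModuleCat.of R M) i := by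
  let P (s : ℕ) : ProjectiveResolution (ModuleCat.of R (R ⧸ 𝔞 ^ s)) := projectiveResolution _
  let φ (s t : ℕ) (h : 𝔞 ^ t ≤ 𝔞 ^ s) : ProjectiveResolution.Hom (P t) (P s) (quotientHom h) :=
    ⟨ProjectiveResolution.lift (quotientHom h) (P t) (P s), by
      simpa using ProjectiveResolution.lift_commutes_zero (quotientHom h) (P t) (P s)⟩
  change ¬ IsZero _ ↔ _
  rw [isZero_localCohomology_iff]
  simp only [HasSurvivingClass, not_forall, not_exists]
  refine exists_congr fun s => ⟨?_, ?_⟩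
  · rintro ⟨x, hx⟩
    obtain ⟨f, hf, rfl⟩ := (P s).cocycleClass_surjective x
    refine ⟨(P s).extMk f (i + 1) rfl hf, fun t h h0 => ?_⟩
    have h' : 𝔞 ^ (max t s) ≤ 𝔞 ^ s := Ideal.pow_le_pow_right (le_max_right t s)
    have h'' : 𝔞 ^ (max t s) ≤ 𝔞 ^ t := Ideal.pow_le_pow_right (le_max_left t s)
    apply hx (max t s) (le_max_right t s)
    rw [ProjectiveResolution.map_cocycleClass (φ s (max t s) h'),
      ProjectiveResolution.cocycleClass_eq_zero_iff_extMk_eq_zero,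
      ← ProjectiveResolution.mk₀_comp_extMk f _ rfl hf,
      ← quotientHom_comp h'' h, ← Abelian.Ext.mk₀_comp_mk₀_assoc, h0, Abelian.Ext.comp_zero]
  · rintro ⟨x, hx⟩
    obtain ⟨f, hf, rfl⟩ := (P s).extMk_surjective x (i + 1) rfl
    refine ⟨(P s).cocycleClass f hf, fun t h h0 => ?_⟩
    have h' : 𝔞 ^ t ≤ 𝔞 ^ s := Ideal.pow_le_pow_right h
    apply hx t h'
    rw [ProjectiveResolution.map_cocycleClass (φ s t h'),
      ProjectiveResolution.cocycleClass_eq_zero_iff_extMk_eq_zero] at h0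
    rw [ProjectiveResolution.mk₀_comp_extMk f _ rfl hf (φ s t h'), h0]

end SurvivingClasses

/-! ### The external tensor product of modules -/

section ExternalTensor

open CategoryTheory CategoryTheory.Limits ModuleCat

variable {k A B : Type u} [Field k] [CommRing A] [Algebra k A] [CommRing B] [Algebra k B]

variable (k) in
/-- The external tensor product `X ⊗ Y`, an `A ⊗ B`-module, of an `A`-module and a `B`-module. The
`k`-module structures of `X` and `Y` are the restrictions along `k → A` and `k → B`. -/
def extTensor (X : ModuleCat.{u} A) (Y : ModuleCat.{u} B) : ModuleCat.{u} (A ⊗[k] B) :=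
  letI := tensorModule k A B X Y
  ModuleCat.of (A ⊗[k] B) (X ⊗[k] Y)

variable (k) in
/-- A pure tensor in the external tensor product. -/
def extTmul {X : ModuleCat.{u} A} {Y : ModuleCat.{u} B} (x : X) (y : Y) : extTensor k X Y :=
  (x ⊗ₜ[k] y : X ⊗[k] Y)

section

variable {X X' X'' : ModuleCat.{u} A} {Y Y' Y'' : ModuleCat.{u} B}

theorem extTensor_induction {motive : extTensor k X Y → Prop} (t : extTensor k X Y)
    (zero : motive 0) (tmul : ∀ x y, motive (extTmul k x y))
    (add : ∀ s t, motive s → motive t → motive (s + t)) : motive t :=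
  TensorProduct.induction_on (motive := motive) t zero tmul add

theorem extTmul_add (x : X) (y y' : Y) : extTmul k x (y + y') = extTmul k x y + extTmul k x y' :=
  TensorProduct.tmul_add x y y'

theorem add_extTmul (x x' : X) (y : Y) : extTmul k (x + x') y = extTmul k x y + extTmul k x' y :=
  TensorProduct.add_tmul x x' y

theorem tmul_smul_extTmul (a : A) (b : B) (x : X) (y : Y) :
    (a ⊗ₜ[k] b) • extTmul k x y = extTmul k (a • x) (b • y) := rfl

theorem extTensor_hom_ext {Z : ModuleCat.{u} (A ⊗[k] B)} {f g : extTensor k X Y ⟶ Z}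
    (h : ∀ x y, f (extTmul k x y) = g (extTmul k x y)) : f = g := by
  ext t
  induction t using extTensor_induction with
  | zero => rw [map_zero, map_zero]
  | tmul x y => exact h x y
  | add s t hs ht => rw [map_add, map_add, hs, ht]

/-- The homomorphism out of the external tensor product that is given on pure tensors by
a `k`-bilinear map compatible with the actions of `A` and `B`. -/
def extTensorLift {Z : ModuleCat.{u} (A ⊗[k] B)} (f : X →ₗ[k] Y →ₗ[k] Z)
    (hf : ∀ (a : A) (b : B) (x : X) (y : Y), f (a • x) (b • y) = (a ⊗ₜ[k] b) • f x y) :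
    extTensor k X Y ⟶ Z :=
  ModuleCat.ofHom (X := extTensor k X Y)
    { (TensorProduct.lift f : X ⊗[k] Y →ₗ[k] Z).toAddMonoidHom with
      map_smul' c t := by
        change (TensorProduct.lift f : X ⊗[k] Y →ₗ[k] Z) (c • t : extTensor k X Y) =
          c • (TensorProduct.lift f : X ⊗[k] Y →ₗ[k] Z) t
        induction t using extTensor_induction with
        | zero =>
          rw [smul_zero]
          exact (map_zero (TensorProduct.lift f : X ⊗[k] Y →ₗ[k] Z)).trans (by
            rw [← smul_zero c]
            exact congrArg _ (map_zero (TensorProduct.lift f : X ⊗[k] Y →ₗ[k] Z)).symm)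
        | tmul x y =>
          induction c using TensorProduct.induction_on with
          | zero =>
            rw [zero_smul, zero_smul]
            exact map_zero (TensorProduct.lift f : X ⊗[k] Y →ₗ[k] Z)
          | tmul a b => exact hf a b x y
          | add c d hc hd =>
            rw [add_smul, add_smul, ← hc, ← hd]
            exact map_add (TensorProduct.lift f : X ⊗[k] Y →ₗ[k] Z) _ _
        | add s t hs ht =>
          rw [smul_add]
          refine (map_add (TensorProduct.lift f : X ⊗[k] Y →ₗ[k] Z) _ _).trans ?_
          rw [hs, ht, ← smul_add]
          exact congrArg _ (map_add (TensorProduct.lift f : X ⊗[k] Y →ₗ[k] Z) s t).symm }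

theorem extTensorLift_apply {Z : ModuleCat.{u} (A ⊗[k] B)} (f : X →ₗ[k] Y →ₗ[k] Z)
    (hf : ∀ (a : A) (b : B) (x : X) (y : Y), f (a • x) (b • y) = (a ⊗ₜ[k] b) • f x y)
    (x : X) (y : Y) : extTensorLift f hf (extTmul k x y) = f x y :=
  TensorProduct.lift.tmul x y

theorem algebraMap_smul_extTmul (c : k) (x : X) (y : Y) :
    (algebraMap k (A ⊗[k] B) c) • extTmul k x y = extTmul k (algebraMap k A c • x) y := by
  rw [Algebra.TensorProduct.algebraMap_apply, tmul_smul_extTmul, one_smul]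

theorem smul_extTmul (c : k) (x : X) (y : Y) :
    c • extTmul k x y = extTmul k (c • x) y :=
  algebraMap_smul_extTmul c x y

theorem extTmul_smul (c : k) (x : X) (y : Y) :
    extTmul k x (c • y) = c • extTmul k x y :=
  (TensorProduct.smul_tmul c x y).symm.trans (smul_extTmul c x y).symm

variable (k) in
/-- The homomorphism `f ⊗ g` between external tensor products. -/
def extTensorMap (f : X ⟶ X') (g : Y ⟶ Y') : extTensor k X Y ⟶ extTensor k X' Y' :=
  extTensorLift (LinearMap.mk₂ k (fun x y => extTmul k (f x) (g y))
    (fun x x' y => by rw [map_add, add_extTmul])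
    (fun c x y => by
      rw [smul_extTmul]
      exact congrArg (fun z => extTmul k z (g y)) (f.hom.map_smul (algebraMap k A c) x))
    (fun x y y' => by rw [map_add, extTmul_add])
    (fun c x y => by
      rw [← extTmul_smul]
      exact congrArg (fun z => extTmul k (f x) z) (g.hom.map_smul (algebraMap k B c) y)))
    (fun a b x y => by simp [tmul_smul_extTmul])

@[simp]
theorem extTensorMap_apply (f : X ⟶ X') (g : Y ⟶ Y') (x : X) (y : Y) :
    extTensorMap k f g (extTmul k x y) = extTmul k (f x) (g y) := rfl

theorem extTensorMap_eq_map (f : X ⟶ X') (g : Y ⟶ Y') (t : X ⊗[k] Y) :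
    extTensorMap k f g t =
      TensorProduct.map (f.hom.restrictScalars k) (g.hom.restrictScalars k) t := by
  induction t using extTensor_induction (k := k) with
  | zero => exact (map_zero (extTensorMap k f g).hom).trans (map_zero (TensorProduct.map
      (f.hom.restrictScalars k) (g.hom.restrictScalars k))).symm
  | tmul x y => rfl
  | add s t hs ht =>
    refine (map_add (extTensorMap k f g).hom s t).trans ?_
    exact (congrArg₂ _ hs ht).trans (map_add (TensorProduct.map
      (f.hom.restrictScalars k) (g.hom.restrictScalars k)) s t).symm

theorem extTensorMap_id : extTensorMap k (𝟙 X) (𝟙 Y) = 𝟙 (extTensor k X Y) :=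
  extTensor_hom_ext fun _ _ => rfl

theorem extTensorMap_comp (f : X ⟶ X') (g : Y ⟶ Y') (f' : X' ⟶ X'') (g' : Y' ⟶ Y'') :
    extTensorMap k f g ≫ extTensorMap k f' g' = extTensorMap k (f ≫ f') (g ≫ g') :=
  extTensor_hom_ext fun _ _ => rfl

end

variable (k A) in
/-- The functor `- ⊗ Y` from `A`-modules to `A ⊗ B`-modules. -/
@[simps]
def extTensorRight (Y : ModuleCat.{u} B) : ModuleCat.{u} A ⥤ ModuleCat.{u} (A ⊗[k] B) where
  obj X := extTensor k X Y
  map f := extTensorMap k f (𝟙 Y)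
  map_id X := extTensorMap_id
  map_comp f g := by rw [extTensorMap_comp, Category.comp_id]

variable (k B) in
/-- The functor `X ⊗ -` from `B`-modules to `A ⊗ B`-modules. -/
@[simps]
def extTensorLeft (X : ModuleCat.{u} A) : ModuleCat.{u} B ⥤ ModuleCat.{u} (A ⊗[k] B) where
  obj Y := extTensor k X Y
  map g := extTensorMap k (𝟙 X) g
  map_id Y := extTensorMap_id
  map_comp f g := by rw [extTensorMap_comp, Category.comp_id]

variable (k A) in
/-- The natural transformation `- ⊗ g`. -/
@[simps]
def extTensorRightMap {Y Y' : ModuleCat.{u} B} (g : Y ⟶ Y') :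
    extTensorRight k A Y ⟶ extTensorRight k A Y' where
  app X := extTensorMap k (𝟙 X) g
  naturality _ _ _ := extTensor_hom_ext fun _ _ => rfl

variable (k B) in
/-- The natural transformation `f ⊗ -`. -/
@[simps]
def extTensorLeftMap {X X' : ModuleCat.{u} A} (f : X ⟶ X') :
    extTensorLeft k B X ⟶ extTensorLeft k B X' where
  app Y := extTensorMap k f (𝟙 Y)
  naturality _ _ _ := extTensor_hom_ext fun _ _ => rfl

instance (Y : ModuleCat.{u} B) : (extTensorRight k A Y).Additive where
  map_add {_ _ f g} := extTensor_hom_ext fun x y => add_extTmul (f x) (g x) y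

instance (X : ModuleCat.{u} A) : (extTensorLeft k B X).Additive where
  map_add {_ _ f g} := extTensor_hom_ext fun x y => extTmul_add x (f y) (g y)

instance (Y : ModuleCat.{u} B) : (extTensorRight k A Y).Linear k where
  map_smul f c := extTensor_hom_ext fun x y => (smul_extTmul c (f x) y).symm

instance (X : ModuleCat.{u} A) : (extTensorLeft k B X).Linear k where
  map_smul f c := extTensor_hom_ext fun x y => extTmul_smul c x (f y)

theorem coe_extTensorMap_id {X X' : ModuleCat.{u} A} (f : X ⟶ X') (Y : ModuleCat.{u} B) :
    (fun t => extTensorMap k f (𝟙 Y) t) =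
      fun t => LinearMap.rTensor Y (f.hom.restrictScalars k) t :=
  funext fun t => extTensorMap_eq_map f (𝟙 Y) t

theorem coe_id_extTensorMap (X : ModuleCat.{u} A) {Y Y' : ModuleCat.{u} B} (g : Y ⟶ Y') :
    (fun t => extTensorMap k (𝟙 X) g t) =
      fun t => LinearMap.lTensor X (g.hom.restrictScalars k) t :=
  funext fun t => extTensorMap_eq_map (𝟙 X) g t

theorem shortExact_map_extTensorRight (Y : ModuleCat.{u} B) {S : ShortComplex (ModuleCat.{u} A)}
    (hS : S.ShortExact) : (S.map (extTensorRight k A Y)).ShortExact := by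
  have h := (ShortComplex.ShortExact.moduleCat_exact_iff_function_exact S).1 hS.exact
  apply ModuleCat.shortComplex_shortExact
  · change Function.Exact (fun t => extTensorMap k S.f (𝟙 Y) t)
      (fun t => extTensorMap k S.g (𝟙 Y) t)
    rw [coe_extTensorMap_id, coe_extTensorMap_id]
    exact rTensor_exact Y (f := S.f.hom.restrictScalars k) (g := S.g.hom.restrictScalars k) h
      hS.moduleCat_surjective_g
  · change Function.Injective (fun t => extTensorMap k S.f (𝟙 Y) t)
    rw [coe_extTensorMap_id]
    exact Module.Flat.rTensor_preserves_injective_linearMap (M := Y)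
      (S.f.hom.restrictScalars k) hS.moduleCat_injective_f
  · change Function.Surjective (fun t => extTensorMap k S.g (𝟙 Y) t)
    rw [coe_extTensorMap_id]
    exact LinearMap.rTensor_surjective Y (g := S.g.hom.restrictScalars k)
      hS.moduleCat_surjective_g

theorem shortExact_map_extTensorLeft (X : ModuleCat.{u} A) {S : ShortComplex (ModuleCat.{u} B)}
    (hS : S.ShortExact) : (S.map (extTensorLeft k B X)).ShortExact := by
  have h := (ShortComplex.ShortExact.moduleCat_exact_iff_function_exact S).1 hS.exact
  apply ModuleCat.shortComplex_shortExact
  · change Function.Exact (fun t => extTensorMap k (𝟙 X) S.f t)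
      (fun t => extTensorMap k (𝟙 X) S.g t)
    rw [coe_id_extTensorMap, coe_id_extTensorMap]
    exact lTensor_exact X (f := S.f.hom.restrictScalars k) (g := S.g.hom.restrictScalars k) h
      hS.moduleCat_surjective_g
  · change Function.Injective (fun t => extTensorMap k (𝟙 X) S.f t)
    rw [coe_id_extTensorMap]
    exact Module.Flat.lTensor_preserves_injective_linearMap (M := X)
      (S.f.hom.restrictScalars k) hS.moduleCat_injective_f
  · change Function.Surjective (fun t => extTensorMap k (𝟙 X) S.g t)
    rw [coe_id_extTensorMap]
    exact LinearMap.lTensor_surjective X (g := S.g.hom.restrictScalars k)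
      hS.moduleCat_surjective_g

instance (Y : ModuleCat.{u} B) : PreservesFiniteLimits (extTensorRight k A Y) :=
  have h : PreservesFiniteLimits (extTensorRight k A Y) ∧
      PreservesFiniteColimits (extTensorRight k A Y) :=
    ((Functor.exact_tfae (extTensorRight k A Y)).out 0 3).1 fun _ hS =>
    shortExact_map_extTensorRight Y hS
  h.1

instance (Y : ModuleCat.{u} B) : PreservesFiniteColimits (extTensorRight k A Y) :=
  have h : PreservesFiniteLimits (extTensorRight k A Y) ∧
      PreservesFiniteColimits (extTensorRight k A Y) :=
    ((Functor.exact_tfae (extTensorRight k A Y)).out 0 3).1 fun _ hS =>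
    shortExact_map_extTensorRight Y hS
  h.2

instance (X : ModuleCat.{u} A) : PreservesFiniteLimits (extTensorLeft k B X) :=
  have h : PreservesFiniteLimits (extTensorLeft k B X) ∧
      PreservesFiniteColimits (extTensorLeft k B X) :=
    ((Functor.exact_tfae (extTensorLeft k B X)).out 0 3).1 fun _ hS =>
    shortExact_map_extTensorLeft X hS
  h.1

instance (X : ModuleCat.{u} A) : PreservesFiniteColimits (extTensorLeft k B X) :=
  have h : PreservesFiniteLimits (extTensorLeft k B X) ∧
      PreservesFiniteColimits (extTensorLeft k B X) :=
    ((Functor.exact_tfae (extTensorLeft k B X)).out 0 3).1 fun _ hS =>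
    shortExact_map_extTensorLeft X hS
  h.2

end ExternalTensor

/-! ### The external product on `Ext` -/

section ExternalProduct

open CategoryTheory CategoryTheory.Limits CategoryTheory.Abelian ModuleCat

variable {k A B : Type u} [Field k] [CommRing A] [Algebra k A] [CommRing B] [Algebra k B]

variable {X X' L : ModuleCat.{u} A} {Y Y' N : ModuleCat.{u} B}

variable (k) in
/-- The class `α ⊗ Y`, the image of `α` under the exact functor `- ⊗ Y`. -/
def extClassTensor {i : ℕ} (α : Abelian.Ext X X' i) (Y : ModuleCat.{u} B) :
    Abelian.Ext (extTensor k X Y) (extTensor k X' Y) i :=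
  α.mapExactFunctor (extTensorRight k A Y)

variable (k) in
/-- The class `X ⊗ β`, the image of `β` under the exact functor `X ⊗ -`. -/
def tensorExtClass {j : ℕ} (X : ModuleCat.{u} A) (β : Abelian.Ext Y Y' j) :
    Abelian.Ext (extTensor k X Y) (extTensor k X Y') j :=
  β.mapExactFunctor (extTensorLeft k B X)

theorem extClassTensor_comp {i j n : ℕ} (h : i + j = n) (α : Abelian.Ext X X' i)
    (β : Abelian.Ext X' L j) : extClassTensor k (α.comp β h) Y =
      (extClassTensor k α Y).comp (extClassTensor k β Y) h :=
  Ext.mapExactFunctor_comp _ _ _ _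

theorem tensorExtClass_comp {i j n : ℕ} (h : i + j = n) (α : Abelian.Ext Y Y' i)
    (β : Abelian.Ext Y' N j) : tensorExtClass k X (α.comp β h) =
      (tensorExtClass k X α).comp (tensorExtClass k X β) h :=
  Ext.mapExactFunctor_comp _ _ _ _

theorem extClassTensor_mk₀ (f : X ⟶ X') :
    extClassTensor k (Ext.mk₀ f) Y = Ext.mk₀ (extTensorMap k f (𝟙 Y)) :=
  Ext.mapExactFunctor_mk₀ _ _

theorem tensorExtClass_mk₀ (g : Y ⟶ Y') :
    tensorExtClass k X (Ext.mk₀ g) = Ext.mk₀ (extTensorMap k (𝟙 X) g) :=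
  Ext.mapExactFunctor_mk₀ _ _

theorem extClassTensor_zero : extClassTensor k (0 : Abelian.Ext X X' 0) Y = 0 :=
  Ext.mapExactFunctor_zero _ _ _ _

theorem tensorExtClass_zero : tensorExtClass k X (0 : Abelian.Ext Y Y' 0) = 0 :=
  Ext.mapExactFunctor_zero _ _ _ _

theorem extClassTensor_comp_mk₀ {i : ℕ} (α : Abelian.Ext X X' i) (g : Y ⟶ Y') :
    (extClassTensor k α Y).comp (Ext.mk₀ (extTensorMap k (𝟙 X') g)) (add_zero i) =
      (Ext.mk₀ (extTensorMap k (𝟙 X) g)).comp (extClassTensor k α Y') (zero_add i) :=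
  Ext_mapExactFunctor_naturality (extTensorRightMap k A g) α

theorem tensorExtClass_comp_mk₀ {j : ℕ} (f : X ⟶ X') (β : Abelian.Ext Y Y' j) :
    (tensorExtClass k X β).comp (Ext.mk₀ (extTensorMap k f (𝟙 Y'))) (add_zero j) =
      (Ext.mk₀ (extTensorMap k f (𝟙 Y))).comp (tensorExtClass k X' β) (zero_add j) :=
  Ext_mapExactFunctor_naturality (extTensorLeftMap k B f) β

variable (k) in
/-- The external product of `α ∈ Ext^i(X, L)` and `β ∈ Ext^j(Y, N)`: the Yoneda composite
`(α ⊗ Y) ∘ (L ⊗ β) ∈ Ext^(i+j)(X ⊗ Y, L ⊗ N)`. -/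
def extProduct {i j n : ℕ} (h : i + j = n) (α : Abelian.Ext X L i) (β : Abelian.Ext Y N j) :
    Abelian.Ext (extTensor k X Y) (extTensor k L N) n :=
  (extClassTensor k α Y).comp (tensorExtClass k L β) h

theorem extProduct_precomp_left {i j n m i' n' : ℕ} (h : i + j = n) (hi : m + i = i')
    (hn : m + n = n') (h' : i' + j = n')
    (γ : Abelian.Ext X' X m) (α : Abelian.Ext X L i) (β : Abelian.Ext Y N j) :
    extProduct k h' (γ.comp α hi) β =
      (extClassTensor k γ Y).comp (extProduct k h α β) hn := by
  unfold extProduct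
  rw [extClassTensor_comp, ← Ext.comp_assoc _ _ _ hi h (by lia)]

/-- Naturality of the external product in `Y`. Only homomorphisms `g` are allowed: for classes of
positive degree a sign would appear when `X ⊗ g` moves past a class `α ⊗ Y` of positive degree. -/
theorem extProduct_precomp_right_of_hom {i j n : ℕ} (h : i + j = n) (g : Y' ⟶ Y)
    (α : Abelian.Ext X L i) (β : Abelian.Ext Y N j) :
    extProduct k h α ((Ext.mk₀ g).comp β (zero_add j)) =
      (Ext.mk₀ (extTensorMap k (𝟙 X) g)).comp (extProduct k h α β) (zero_add n) := by
  unfold extProduct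
  rw [tensorExtClass_comp, tensorExtClass_mk₀,
    ← Ext.comp_assoc _ _ _ (zero_add i) h (by lia), ← extClassTensor_comp_mk₀,
    Ext.comp_assoc_of_second_deg_zero]

/-- Precomposition with a class in the second variable, for a first factor of degree zero. This is
enough to shift degrees in `Y` when `X` is free. -/
theorem extProduct_precomp_right_of_hom_left {j m j' : ℕ} (hj : m + j = j')
    (f : X ⟶ L) (γ : Abelian.Ext Y' Y m) (β : Abelian.Ext Y N j) :
    extProduct k (zero_add j') (Ext.mk₀ f) (γ.comp β hj) =
      (tensorExtClass k X γ).comp (extProduct k (zero_add j) (Ext.mk₀ f) β) hj := by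
  unfold extProduct
  rw [tensorExtClass_comp, extClassTensor_mk₀, extClassTensor_mk₀,
    ← Ext.comp_assoc _ _ _ (zero_add m) hj (by lia), ← tensorExtClass_comp_mk₀,
    Ext.comp_assoc_of_second_deg_zero]

variable (k X L Y N) in
/-- The external product, as a linear map on `Ext^i(X, L) ⊗ Ext^j(Y, N)`. It takes values in
`Ext^n(X ⊗ Y, L ⊗ N)` for an arbitrary `n`, and is zero by convention unless `i + j = n`. -/
def extProductMap (i j n : ℕ) :
    Abelian.Ext X L i ⊗[k] Abelian.Ext Y N j →ₗ[k]
      Abelian.Ext (extTensor k X Y) (extTensor k L N) n :=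
  if h : i + j = n then
    TensorProduct.lift (LinearMap.mk₂ k (extProduct k h)
      (fun α α' β => by
        unfold extProduct extClassTensor
        rw [Ext.mapExactFunctor_add]
        exact Ext.add_comp _ _ _ _)
      (fun c α β => by
        unfold extProduct extClassTensor
        rw [Functor.mapExactFunctor_smul]
        exact Ext.smul_comp _ _ _ _)
      (fun α β β' => by
        unfold extProduct tensorExtClass
        rw [Ext.mapExactFunctor_add]
        exact Ext.comp_add _ _ _ _)
      (fun c α β => by
        unfold extProduct tensorExtClass
        rw [Functor.mapExactFunctor_smul]
        exact Ext.comp_smul _ _ _ _))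
  else 0

theorem extProductMap_tmul {i j n : ℕ} (h : i + j = n) (α : Abelian.Ext X L i)
    (β : Abelian.Ext Y N j) :
    extProductMap k X L Y N i j n (α ⊗ₜ β) = extProduct k h α β := by
  rw [extProductMap, dif_pos h]
  rfl

theorem extProductMap_of_ne {i j n : ℕ} (h : i + j ≠ n) :
    extProductMap k X L Y N i j n = 0 := by
  rw [extProductMap, dif_neg h]

theorem extProductMap_rTensor {m i i' j n n' : ℕ} (hi : m + i = i') (hn : m + n = n')
    (γ : Abelian.Ext X' X m) (t : Abelian.Ext X L i ⊗[k] Abelian.Ext Y N j) :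
    extProductMap k X' L Y N i' j n' ((γ.precompOfLinear k L hi).rTensor _ t) =
      (extClassTensor k γ Y).comp (extProductMap k X L Y N i j n t) hn := by
  by_cases h : i + j = n
  · induction t using TensorProduct.induction_on with
    | zero => simp
    | tmul α β =>
      rw [LinearMap.rTensor_tmul, extProductMap_tmul h,
        extProductMap_tmul (show i' + j = n' by lia)]
      exact extProduct_precomp_left h hi hn _ γ α β
    | add s t hs ht => rw [map_add, map_add, map_add, hs, ht, Ext.comp_add]
  · rw [extProductMap_of_ne h, extProductMap_of_ne (show i' + j ≠ n' by lia)]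
    simp

theorem extProductMap_lTensor {j m j' : ℕ} (hj : m + j = j')
    (γ : Abelian.Ext Y' Y m) (t : Abelian.Ext X L 0 ⊗[k] Abelian.Ext Y N j) :
    extProductMap k X L Y' N 0 j' j' ((γ.precompOfLinear k N hj).lTensor _ t) =
      (tensorExtClass k X γ).comp (extProductMap k X L Y N 0 j j t) hj := by
  induction t using TensorProduct.induction_on with
  | zero => simp
  | tmul α β =>
    obtain ⟨f, rfl⟩ := (Ext.mk₀_bijective X L).2 α
    rw [LinearMap.lTensor_tmul, extProductMap_tmul (zero_add j), extProductMap_tmul (zero_add j')]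
    exact extProduct_precomp_right_of_hom_left hj f γ β
  | add s t hs ht => rw [map_add, map_add, map_add, hs, ht, Ext.comp_add]

end ExternalProduct

/-! ### External tensor products of finite free modules -/

section FreeModules

open CategoryTheory CategoryTheory.Limits CategoryTheory.Abelian ModuleCat

variable {k A B : Type u} [Field k] [CommRing A] [Algebra k A] [CommRing B] [Algebra k B]
variable {X L : ModuleCat.{u} A} {Y N : ModuleCat.{u} B} {ι κ : Type} [Fintype ι] [Fintype κ]
  (b : Module.Basis ι A X) (c : Module.Basis κ B Y)

include b c in
theorem extTmul_eq_sum (x : X) (y : Y) : extTmul k x y =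
    ∑ p, ∑ q, (b.repr x p ⊗ₜ[k] c.repr y q : A ⊗[k] B) • extTmul k (b p) (c q) := by
  have hx (y : Y) : extTmul k (∑ p, b.repr x p • b p) y =
      ∑ p, extTmul k (b.repr x p • b p) y :=
    map_sum (AddMonoidHom.mk' (fun x => extTmul k x y) fun x x' => add_extTmul x x' y) _ _
  have hy (x : X) : extTmul k x (∑ q, c.repr y q • c q) =
      ∑ q, extTmul k x (c.repr y q • c q) :=
    map_sum (AddMonoidHom.mk' (fun y => extTmul k x y) fun y y' => extTmul_add x y y') _ _
  conv_lhs => rw [← b.sum_repr x, ← c.sum_repr y, hx]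
  refine Finset.sum_congr rfl fun p _ => ?_
  rw [hy]
  rfl

include b c in
theorem extTensor_hom_ext_basis {Z : ModuleCat.{u} (A ⊗[k] B)} {f g : extTensor k X Y ⟶ Z}
    (h : ∀ p q, f (extTmul k (b p) (c q)) = g (extTmul k (b p) (c q))) : f = g := by
  refine extTensor_hom_ext fun x y => ?_
  rw [extTmul_eq_sum b c x y]
  simp only [map_sum, map_smul, h]

theorem Module.Basis.repr_restrictScalars_smul {ι : Type} (b : Module.Basis ι A X) (r : k) (x : X)
    (p : ι) :
    b.repr (r • x) p = r • b.repr x p := by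
  rw [Algebra.smul_def]
  exact congrArg (fun z => z p) (b.repr.map_smul (algebraMap k A r) x)

/-- The homomorphism out of the external tensor product of two finite free modules with
prescribed values on the tensors of basis vectors. -/
def extTensorConstr {Z : ModuleCat.{u} (A ⊗[k] B)} (z : ι → κ → Z) : extTensor k X Y ⟶ Z :=
  extTensorLift (LinearMap.mk₂ k
    (fun x y => ∑ p, ∑ q, (b.repr x p ⊗ₜ[k] c.repr y q : A ⊗[k] B) • z p q)
    (fun x x' y => by simp [TensorProduct.add_tmul, add_smul, Finset.sum_add_distrib])
    (fun r x y => by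
      simp only [Module.Basis.repr_restrictScalars_smul, Finset.smul_sum,
        ← TensorProduct.smul_tmul', smul_assoc])
    (fun x y y' => by simp [TensorProduct.tmul_add, add_smul, Finset.sum_add_distrib])
    (fun r x y => by
      simp only [Module.Basis.repr_restrictScalars_smul, Finset.smul_sum,
        TensorProduct.tmul_smul, smul_assoc]))
    (fun r s x y => by
      simp only [LinearMap.mk₂_apply, Finset.smul_sum, smul_smul, map_smul, Finsupp.smul_apply,
        smul_eq_mul, Algebra.TensorProduct.tmul_mul_tmul])

theorem extTensorConstr_apply {Z : ModuleCat.{u} (A ⊗[k] B)} (z : ι → κ → Z) (p : ι) (q : κ) :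
    extTensorConstr b c z (extTmul k (b p) (c q)) = z p q := by
  classical
  refine (extTensorLift_apply _ _ _ _).trans ?_
  rw [LinearMap.mk₂_apply, Finset.sum_eq_single p, Finset.sum_eq_single q]
  · rw [b.repr_self, c.repr_self, Finsupp.single_eq_same, Finsupp.single_eq_same,
      ← Algebra.TensorProduct.one_def, one_smul]
  · intro q' _ hq
    rw [c.repr_self, Finsupp.single_eq_of_ne hq, TensorProduct.tmul_zero, zero_smul]
  · exact fun h => (h (Finset.mem_univ q)).elim
  · intro p' _ hp
    refine Finset.sum_eq_zero fun q' _ => ?_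
    rw [b.repr_self, Finsupp.single_eq_of_ne hp, TensorProduct.zero_tmul, zero_smul]
  · exact fun h => (h (Finset.mem_univ p)).elim

include b c in
/-- Projectivity of `X ⊗ Y` for finite free `X` and `Y`, by lifting the images of the tensors of
basis vectors. -/
theorem projective_extTensor : Projective (extTensor k X Y) where
  factors {E Z} f e he := by
    have hs := (ModuleCat.epi_iff_surjective e).1 he
    choose z hz using fun p q => hs (f (extTmul k (b p) (c q)))
    refine ⟨extTensorConstr b c z, extTensor_hom_ext_basis b c fun p q => ?_⟩
    rw [ModuleCat.comp_apply, extTensorConstr_apply, hz]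

end FreeModules

/-! ### The external product in degree zero for finite free modules -/

section FreeHom

open CategoryTheory CategoryTheory.Limits CategoryTheory.Abelian ModuleCat

variable {k A B : Type u} [Field k] [CommRing A] [Algebra k A] [CommRing B] [Algebra k B]
variable {X L : ModuleCat.{u} A} {Y N : ModuleCat.{u} B} {ι κ : Type}
  (b : Module.Basis ι A X) (c : Module.Basis κ B Y)

variable (k) in
/-- The homomorphism out of a free module taking one basis vector to `l` and the others to zero,
as a class in `Ext^0`, depending linearly on `l`. -/
def basisExtZero (p : ι) : L →ₗ[k] Abelian.Ext X L 0 where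
  toFun l := Ext.mk₀ (ModuleCat.ofHom ((LinearMap.toSpanSingleton A L l).comp (b.coord p)))
  map_add' l l' := by
    rw [← Ext.mk₀_add]
    congr 1
    ext x
    exact smul_add _ _ _
  map_smul' r l := by
    rw [RingHom.id_apply, ← Ext.mk₀_smul]
    congr 1
    ext x
    exact smul_comm (b.repr x p) (algebraMap k A r) l

theorem sum_basisExtZero [Fintype ι] (f : X ⟶ L) :
    ∑ p, basisExtZero k b p (f (b p)) = Ext.mk₀ f := by
  change ∑ p, Ext.mk₀ _ = _
  rw [← Ext.mk₀_sum]
  congr 1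
  ext x
  rw [ModuleCat.hom_sum, LinearMap.sum_apply]
  conv_rhs => rw [← b.sum_repr x, map_sum]
  exact Finset.sum_congr rfl fun p _ => (f.hom.map_smul (b.repr x p) (b p)).symm

variable {Z : ModuleCat.{u} (A ⊗[k] B)}

/-- Evaluation at a tensor of basis vectors. -/
def evalBasis (p : ι) (q : κ) : Abelian.Ext (extTensor k X Y) Z 0 →+ Z where
  toFun α := Ext.addEquiv₀ α (extTmul k (b p) (c q))
  map_zero' := by rw [map_zero]; rfl
  map_add' α β := by rw [map_add]; rfl

theorem evalBasis_mk₀ (p : ι) (q : κ) (f : extTensor k X Y ⟶ Z) :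
    evalBasis b c p q (Ext.mk₀ f) = f (extTmul k (b p) (c q)) := by
  change Ext.addEquiv₀ (Ext.addEquiv₀.symm f) _ = _
  rw [AddEquiv.apply_symm_apply]

theorem ext_evalBasis [Fintype ι] [Fintype κ] {α β : Abelian.Ext (extTensor k X Y) Z 0}
    (h : ∀ p q, evalBasis b c p q α = evalBasis b c p q β) : α = β := by
  obtain ⟨f, rfl⟩ := (Ext.mk₀_bijective _ _).2 α
  obtain ⟨g, rfl⟩ := (Ext.mk₀_bijective _ _).2 β
  simp only [evalBasis_mk₀] at h
  rw [extTensor_hom_ext_basis b c h]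

variable (k N) in
/-- The tensor product of two of the maps `basisExtZero`. -/
def basisExtZeroTensor (L : ModuleCat.{u} A) (N : ModuleCat.{u} B) (p : ι) (q : κ) :
    extTensor k L N →+ Abelian.Ext X L 0 ⊗[k] Abelian.Ext Y N 0 :=
  (TensorProduct.map (basisExtZero k b p) (basisExtZero k c q) :
    L ⊗[k] N →ₗ[k] _).toAddMonoidHom

theorem basisExtZeroTensor_extTmul (p : ι) (q : κ) (l : L) (n : N) :
    basisExtZeroTensor k b c L N p q (extTmul k l n) =
      basisExtZero k b p l ⊗ₜ basisExtZero k c q n := rfl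

variable [Fintype ι] [Fintype κ]

/-- The inverse of the external product `Ext^0(X, L) ⊗ Ext^0(Y, N) → Ext^0(X ⊗ Y, L ⊗ N)`
for finite free modules `X` and `Y`. -/
def extProductMapZeroInv : Abelian.Ext (extTensor k X Y) (extTensor k L N) 0 →+
    Abelian.Ext X L 0 ⊗[k] Abelian.Ext Y N 0 :=
  ∑ p, ∑ q, (basisExtZeroTensor k b c L N p q).comp (evalBasis b c p q)

theorem extProduct_mk₀_mk₀ (f : X ⟶ L) (g : Y ⟶ N) :
    extProduct k (zero_add 0) (Ext.mk₀ f) (Ext.mk₀ g) = Ext.mk₀ (extTensorMap k f g) := by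
  unfold extProduct
  rw [extClassTensor_mk₀, tensorExtClass_mk₀, Ext.mk₀_comp_mk₀, extTensorMap_comp,
    Category.comp_id, Category.id_comp]

theorem extProductMapZeroInv_apply (t : Abelian.Ext X L 0 ⊗[k] Abelian.Ext Y N 0) :
    extProductMapZeroInv b c (extProductMap k X L Y N 0 0 0 t) = t := by
  induction t using TensorProduct.induction_on with
  | zero => simp
  | tmul α β =>
    obtain ⟨f, rfl⟩ := (Ext.mk₀_bijective _ _).2 α
    obtain ⟨g, rfl⟩ := (Ext.mk₀_bijective _ _).2 β
    rw [extProductMap_tmul (zero_add 0), extProduct_mk₀_mk₀]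
    conv_rhs => rw [← sum_basisExtZero (k := k) b f, ← sum_basisExtZero (k := k) c g,
      TensorProduct.sum_tmul]
    simp only [extProductMapZeroInv, AddMonoidHom.finsetSum_apply, TensorProduct.tmul_sum]
    refine Finset.sum_congr rfl fun p _ => Finset.sum_congr rfl fun q _ => ?_
    rw [AddMonoidHom.comp_apply, evalBasis_mk₀, extTensorMap_apply, basisExtZeroTensor_extTmul]
  | add s t hs ht => rw [map_add, map_add, hs, ht]

theorem extProductMap_extProductMapZeroInv
    (α : Abelian.Ext (extTensor k X Y) (extTensor k L N) 0) :
    extProductMap k X L Y N 0 0 0 (extProductMapZeroInv b c α) = α := by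
  classical
  have key (p p' : ι) (q q' : κ) (w : extTensor k L N) : evalBasis b c p' q'
      (extProductMap k X L Y N 0 0 0 (basisExtZeroTensor k b c L N p q w)) =
        if p = p' then if q = q' then w else 0 else 0 := by
    induction w using extTensor_induction with
    | zero => simp
    | tmul l n =>
      have e : ∀ (r : A) (s : B), extTmul k (r • l) (s • n) = (r ⊗ₜ[k] s) • extTmul k l n :=
        fun _ _ => rfl
      rw [basisExtZeroTensor_extTmul, extProductMap_tmul (zero_add 0)]
      refine (congrArg _ (extProduct_mk₀_mk₀ _ _)).trans ?_
      rw [evalBasis_mk₀, extTensorMap_apply]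
      refine (e (b.repr (b p') p) (c.repr (c q') q)).trans ?_
      rw [b.repr_self, c.repr_self, Finsupp.single_apply, Finsupp.single_apply]
      by_cases hp : p = p'
      · by_cases hq : q = q'
        · simp [hp, hq, ← Algebra.TensorProduct.one_def]
        · simp [hq, Ne.symm hq]
      · simp [hp, Ne.symm hp]
    | add s t hs ht =>
      rw [map_add, map_add, map_add, hs, ht]
      split_ifs <;> simp
  refine ext_evalBasis b c fun p' q' => ?_
  simp only [extProductMapZeroInv, AddMonoidHom.finsetSum_apply, map_sum, AddMonoidHom.comp_apply,
    key, Finset.sum_ite_eq', Finset.mem_univ, if_true, Finset.sum_ite_irrel, Finset.sum_const_zero]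

include b c in
theorem extProductMap_zero_bijective : Function.Bijective (extProductMap k X L Y N 0 0 0) :=
  Function.bijective_iff_has_inverse.2 ⟨extProductMapZeroInv b c,
    extProductMapZeroInv_apply b c, extProductMap_extProductMapZeroInv b c⟩

end FreeHom

/-! ### Long exact sequences -/

section LongExactSequences

open CategoryTheory CategoryTheory.Limits CategoryTheory.Abelian ModuleCat

section

universe v' u₁ w
variable {C : Type u₁} [Category.{v'} C] [Abelian C] [HasExt.{w} C] (k : Type u) [Field k]
  [Linear k C] {S : ShortComplex C} (hS : S.ShortExact) (Z : C)

include hS in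
theorem exact_precomp_g_precomp_f (n : ℕ) :
    Function.Exact ((Ext.mk₀ S.g).precompOfLinear k Z (zero_add n))
      ((Ext.mk₀ S.f).precompOfLinear k Z (zero_add n)) := fun x =>
  ⟨fun hx => Ext.contravariant_sequence_exact₂ hS Z x hx, by
    rintro ⟨y, rfl⟩
    simp⟩

theorem exact_precomp_f_precomp_extClass {n n' : ℕ} (h : 1 + n = n') :
    Function.Exact ((Ext.mk₀ S.f).precompOfLinear k Z (zero_add n))
      (hS.extClass.precompOfLinear k Z h) := fun x =>
  ⟨fun hx => Ext.contravariant_sequence_exact₁ hS Z x h hx, by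
    rintro ⟨y, rfl⟩
    simp⟩

end

variable {k A B : Type u} [Field k] [CommRing A] [Algebra k A] [CommRing B] [Algebra k B]

section

variable {S : ShortComplex (ModuleCat.{u} A)} (hS : S.ShortExact) (Y : ModuleCat.{u} B)
  {Z : ModuleCat.{u} (A ⊗[k] B)}

theorem extClassTensor_exact₁ {n n' : ℕ} (h : 1 + n = n')
    (w : Abelian.Ext (extTensor k S.X₁ Y) Z n)
    (hw : (extClassTensor k hS.extClass Y).comp w h = 0) :
    ∃ v : Abelian.Ext (extTensor k S.X₂ Y) Z n,
      (extClassTensor k (Ext.mk₀ S.f) Y).comp v (zero_add n) = w := by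
  rw [extClassTensor, Ext.mapExactFunctor_extClass] at hw
  rw [extClassTensor, Ext.mapExactFunctor_mk₀]
  exact Ext.contravariant_sequence_exact₁ (hS.map_of_exact (extTensorRight k A Y)) Z w h hw

theorem extClassTensor_exact₃ {n n' : ℕ} (h : 1 + n = n')
    (w : Abelian.Ext (extTensor k S.X₃ Y) Z n')
    (hw : (extClassTensor k (Ext.mk₀ S.g) Y).comp w (zero_add n') = 0) :
    ∃ v : Abelian.Ext (extTensor k S.X₁ Y) Z n,
      (extClassTensor k hS.extClass Y).comp v h = w := by
  rw [extClassTensor, Ext.mapExactFunctor_mk₀] at hw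
  rw [extClassTensor, Ext.mapExactFunctor_extClass]
  exact Ext.contravariant_sequence_exact₃ (hS.map_of_exact (extTensorRight k A Y)) Z w hw h

include hS in
theorem extClassTensor_injective (w : Abelian.Ext (extTensor k S.X₃ Y) Z 0)
    (hw : (extClassTensor k (Ext.mk₀ S.g) Y).comp w (zero_add 0) = 0) : w = 0 := by
  rw [extClassTensor, Ext.mapExactFunctor_mk₀] at hw
  have := (hS.map_of_exact (extTensorRight k A Y)).epi_g
  exact (injective_iff_map_eq_zero _).1
    (Ext.precomp_mk₀_injective_of_epi Z (S.map (extTensorRight k A Y)).g) w hw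

end

section

variable {S : ShortComplex (ModuleCat.{u} B)} (hS : S.ShortExact) (X : ModuleCat.{u} A)
  {Z : ModuleCat.{u} (A ⊗[k] B)}

theorem tensorExtClass_exact₁ {n n' : ℕ} (h : 1 + n = n')
    (w : Abelian.Ext (extTensor k X S.X₁) Z n)
    (hw : (tensorExtClass k X hS.extClass).comp w h = 0) :
    ∃ v : Abelian.Ext (extTensor k X S.X₂) Z n,
      (tensorExtClass k X (Ext.mk₀ S.f)).comp v (zero_add n) = w := by
  rw [tensorExtClass, Ext.mapExactFunctor_extClass] at hw
  rw [tensorExtClass, Ext.mapExactFunctor_mk₀]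
  exact Ext.contravariant_sequence_exact₁ (hS.map_of_exact (extTensorLeft k B X)) Z w h hw

theorem tensorExtClass_exact₃ {n n' : ℕ} (h : 1 + n = n')
    (w : Abelian.Ext (extTensor k X S.X₃) Z n')
    (hw : (tensorExtClass k X (Ext.mk₀ S.g)).comp w (zero_add n') = 0) :
    ∃ v : Abelian.Ext (extTensor k X S.X₁) Z n,
      (tensorExtClass k X hS.extClass).comp v h = w := by
  rw [tensorExtClass, Ext.mapExactFunctor_mk₀] at hw
  rw [tensorExtClass, Ext.mapExactFunctor_extClass]
  exact Ext.contravariant_sequence_exact₃ (hS.map_of_exact (extTensorLeft k B X)) Z w hw h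

include hS in
theorem tensorExtClass_injective (w : Abelian.Ext (extTensor k X S.X₃) Z 0)
    (hw : (tensorExtClass k X (Ext.mk₀ S.g)).comp w (zero_add 0) = 0) : w = 0 := by
  rw [tensorExtClass, Ext.mapExactFunctor_mk₀] at hw
  have := (hS.map_of_exact (extTensorLeft k B X)).epi_g
  exact (injective_iff_map_eq_zero _).1
    (Ext.precomp_mk₀_injective_of_epi Z (S.map (extTensorLeft k B X)).g) w hw

end

end LongExactSequences

/-! ### The Künneth formula for `Ext` -/

section Kunneth

open CategoryTheory CategoryTheory.Limits CategoryTheory.Abelian ModuleCat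

variable {k A B : Type u} [Field k] [CommRing A] [Algebra k A] [CommRing B] [Algebra k B]

/-- A finitely generated module is the quotient of a finite free module by a finitely generated one.
-/
theorem exists_shortExact_free_finite {R : Type u} [CommRing R] [IsNoetherianRing R]
    (M : ModuleCat.{u} R) [Module.Finite R M] :
    ∃ (r : ℕ) (K : ModuleCat.{u} R) (f : K ⟶ ModuleCat.of R (Fin r → R))
      (g : ModuleCat.of R (Fin r → R) ⟶ M) (w : f ≫ g = 0),
      Module.Finite R K ∧ (ShortComplex.mk f g w).ShortExact := by
  obtain ⟨r, g, hg⟩ := Module.Finite.exists_fin' R M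
  exact ⟨r, _, _, _, g.shortComplexKer.zero, inferInstanceAs (Module.Finite R (LinearMap.ker g)),
    LinearMap.shortExact_shortComplexKer hg⟩

variable {X L : ModuleCat.{u} A} {Y N : ModuleCat.{u} B}

section FreeLeft

variable [IsNoetherianRing B]

variable (k L N) in
/-- In degree zero, a finite free cover of `Y` induces injections on both sides of the external
product, which reduces injectivity to the case of two free modules. -/
theorem extProductMap_injective_of_free_zero (r : ℕ) (Y : ModuleCat.{u} B) [Module.Finite B Y] :
    Function.Injective (extProductMap k (ModuleCat.of A (Fin r → A)) L Y N 0 0 0) := by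
  obtain ⟨s, K, f, g, w, hK, hS⟩ := exists_shortExact_free_finite Y
  rw [injective_iff_map_eq_zero]
  intro t ht
  have h1 := extProductMap_lTensor (k := k) (X := ModuleCat.of A (Fin r → A)) (L := L)
    (zero_add 0) (Ext.mk₀ g) t
  rw [ht, Ext.comp_zero] at h1
  have h2 := (extProductMap_zero_bijective (Pi.basisFun A (Fin r)) (Pi.basisFun B (Fin s))).1
    (h1.trans (map_zero _).symm)
  have hg : Epi g := hS.epi_g
  exact (injective_iff_map_eq_zero _).1 (Module.Flat.lTensor_preserves_injective_linearMap
    (M := Abelian.Ext _ L 0) ((Ext.mk₀ g).precompOfLinear k N (zero_add 0))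
    (Ext.precomp_mk₀_injective_of_epi N g)) t h2

variable (k L N) in
/-- The Künneth formula for finite free `X`, where only `Ext^0(X, L) ⊗ Ext^n(Y, N)` contributes. The
proof shifts degrees along a presentation of `Y` by a finite free module. -/
theorem extProductMap_bijective_of_free (r n : ℕ) (Y : ModuleCat.{u} B) [Module.Finite B Y] :
    Function.Bijective (extProductMap k (ModuleCat.of A (Fin r → A)) L Y N 0 n n) := by
  set X := ModuleCat.of A (Fin r → A)
  let b : Module.Basis (Fin r) A X := Pi.basisFun A (Fin r)
  induction n generalizing Y with
  | zero =>
    refine ⟨extProductMap_injective_of_free_zero k L N r Y, fun z => ?_⟩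
    obtain ⟨s, K, f, g, w, hK, hS⟩ := exists_shortExact_free_finite Y
    obtain ⟨t, ht⟩ := (extProductMap_zero_bijective b (Pi.basisFun B (Fin s))).2
      ((tensorExtClass k X (Ext.mk₀ g)).comp z (zero_add 0))
    have h1 := extProductMap_lTensor (k := k) (X := X) (L := L) (zero_add 0) (Ext.mk₀ f) t
    rw [ht, ← Ext.comp_assoc _ _ _ (zero_add 0) (zero_add 0) (by lia), ← tensorExtClass_comp,
      Ext.mk₀_comp_mk₀, w, Ext.mk₀_zero, tensorExtClass_zero, Ext.zero_comp] at h1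
    have h2 := (injective_iff_map_eq_zero _).1
      (extProductMap_injective_of_free_zero k L N r K) _ h1
    obtain ⟨v, rfl⟩ := (Module.Flat.lTensor_exact (Abelian.Ext X L 0)
      (exact_precomp_g_precomp_f k hS N 0) t).1 h2
    refine ⟨v, ?_⟩
    have h3 := extProductMap_lTensor (k := k) (X := X) (L := L) (zero_add 0) (Ext.mk₀ g) v
    rw [← sub_eq_zero]
    apply tensorExtClass_injective hS X
    rw [sub_eq_add_neg, Ext.comp_add, Ext.comp_neg, ← sub_eq_add_neg, sub_eq_zero]
    exact h3.symm.trans ht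
  | succ n ih =>
    obtain ⟨s, K, f, g, w, hK, hS⟩ := exists_shortExact_free_finite Y
    have hproj : Projective (extTensor k X (ModuleCat.of B (Fin s → B))) :=
      projective_extTensor b (Pi.basisFun B (Fin s))
    have hsurj : Function.Surjective ((hS.extClass.precompOfLinear k N (add_comm 1 n)).lTensor
        (Abelian.Ext X L 0)) :=
      LinearMap.lTensor_surjective _ (fun x =>
        Ext.contravariant_sequence_exact₃ hS N x (Ext.eq_zero_of_projective _) (add_comm 1 n))
    have hδ := fun t => extProductMap_lTensor (k := k) (X := X) (L := L) (N := N)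
      (add_comm 1 n) hS.extClass t
    constructor
    · rw [injective_iff_map_eq_zero]
      intro t ht
      obtain ⟨t, rfl⟩ := hsurj t
      obtain ⟨v, hv⟩ := tensorExtClass_exact₁ hS X _ _ ((hδ t).symm.trans ht)
      obtain ⟨q, rfl⟩ := (ih (ModuleCat.of B (Fin s → B))).2 v
      have h1 := extProductMap_lTensor (k := k) (X := X) (L := L) (zero_add n) (Ext.mk₀ f) q
      have h2 := (ih K).1 (h1.trans hv)
      rw [← h2]
      exact (Module.Flat.lTensor_exact (Abelian.Ext X L 0)
        (exact_precomp_f_precomp_extClass k hS N (add_comm 1 n)) _).2 ⟨q, rfl⟩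
    · intro z
      obtain ⟨y, rfl⟩ := tensorExtClass_exact₃ hS X (add_comm 1 n) z (Ext.eq_zero_of_projective _)
      obtain ⟨t, rfl⟩ := (ih K).2 y
      exact ⟨_, hδ t⟩

end FreeLeft

/-- The sum in `Ext^n(X ⊗ Y, L ⊗ N)` of the external products of the components `t i j` with
`i + j = n`. The components of a family `t` outside the total degree `n` play no role. -/
def kunnethSum (n : ℕ) (t : ∀ i j : ℕ, Abelian.Ext X L i ⊗[k] Abelian.Ext Y N j) :
    Abelian.Ext (extTensor k X Y) (extTensor k L N) n :=
  ∑ p ∈ Finset.HasAntidiagonal.antidiagonal n, extProductMap k X L Y N p.1 p.2 n (t p.1 p.2)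

theorem kunnethSum_zero (t : ∀ i j : ℕ, Abelian.Ext X L i ⊗[k] Abelian.Ext Y N j) :
    kunnethSum 0 t = extProductMap k X L Y N 0 0 0 (t 0 0) := by
  simp [kunnethSum]

theorem kunnethSum_succ (n : ℕ) (t : ∀ i j : ℕ, Abelian.Ext X L i ⊗[k] Abelian.Ext Y N j) :
    kunnethSum (n + 1) t = extProductMap k X L Y N 0 (n + 1) (n + 1) (t 0 (n + 1)) +
      ∑ p ∈ Finset.HasAntidiagonal.antidiagonal n,
        extProductMap k X L Y N (p.1 + 1) p.2 (n + 1) (t (p.1 + 1) p.2) :=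
  Finset.Nat.sum_antidiagonal_succ
    (f := fun p => extProductMap k X L Y N p.1 p.2 (n + 1) (t p.1 p.2))

theorem kunnethSum_sub (n : ℕ) (t t' : ∀ i j : ℕ, Abelian.Ext X L i ⊗[k] Abelian.Ext Y N j) :
    kunnethSum n (fun i j => t i j - t' i j) = kunnethSum n t - kunnethSum n t' := by
  simp [kunnethSum]

theorem kunnethSum_precomp {X' : ModuleCat.{u} A} (γ : Abelian.Ext X' X 0) (n : ℕ)
    (t : ∀ i j : ℕ, Abelian.Ext X L i ⊗[k] Abelian.Ext Y N j) :
    kunnethSum n (fun i j => (γ.precompOfLinear k L (zero_add i)).rTensor _ (t i j)) =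
      (extClassTensor k γ Y).comp (kunnethSum n t) (zero_add n) := by
  unfold kunnethSum
  simp only [extProductMap_rTensor (zero_add _) (zero_add n)]
  exact (map_sum ((extClassTensor k γ Y).precomp (extTensor k L N) (zero_add n)) _ _).symm

theorem sum_extProductMap_precomp_one {X' : ModuleCat.{u} A} (γ : Abelian.Ext X' X 1) (n : ℕ)
    (t : ∀ i j : ℕ, Abelian.Ext X L i ⊗[k] Abelian.Ext Y N j) :
    ∑ p ∈ Finset.HasAntidiagonal.antidiagonal n, extProductMap k X' L Y N (p.1 + 1) p.2 (n + 1)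
      ((γ.precompOfLinear k L (add_comm 1 p.1)).rTensor _ (t p.1 p.2)) =
      (extClassTensor k γ Y).comp (kunnethSum n t) (add_comm 1 n) := by
  unfold kunnethSum
  simp only [extProductMap_rTensor (add_comm 1 _) (add_comm 1 n)]
  exact (map_sum ((extClassTensor k γ Y).precomp (extTensor k L N) (add_comm 1 n)) _ _).symm

/-- For projective `X` only the component in bidegree `(0, n)` contributes. -/
theorem kunnethSum_of_projective [Projective X] (n : ℕ)
    (t : ∀ i j : ℕ, Abelian.Ext X L i ⊗[k] Abelian.Ext Y N j) :
    kunnethSum n t = extProductMap k X L Y N 0 n n (t 0 n) := by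
  cases n with
  | zero => exact kunnethSum_zero t
  | succ n =>
    rw [kunnethSum_succ, add_eq_left]
    refine Finset.sum_eq_zero fun p _ => ?_
    have := Ext.subsingleton_of_projective X L p.1
    rw [Subsingleton.elim (t (p.1 + 1) p.2) 0, map_zero]

theorem exists_kunnethSum_eq_extProductMap {i j n : ℕ} (h : i + j = n)
    (s : Abelian.Ext X L i ⊗[k] Abelian.Ext Y N j) :
    ∃ t : ∀ i j : ℕ, Abelian.Ext X L i ⊗[k] Abelian.Ext Y N j,
      t i j = s ∧ kunnethSum n t = extProductMap k X L Y N i j n s := by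
  classical
  let t : ∀ i j : ℕ, Abelian.Ext X L i ⊗[k] Abelian.Ext Y N j :=
    fun i' j' => if h : i' = i ∧ j' = j then h.1 ▸ h.2 ▸ s else 0
  have ht : t i j = s := by simp [t]
  refine ⟨t, ht, ?_⟩
  rw [kunnethSum, Finset.sum_eq_single (i, j), ht]
  · rintro ⟨p, q⟩ _ hp
    have hp' : ¬ (p = i ∧ q = j) := fun h => hp (Prod.ext h.1 h.2)
    simp [t, hp']
  · exact fun h' => (h' (Finset.HasAntidiagonal.mem_antidiagonal.2 h)).elim

variable [IsNoetherianRing A] [IsNoetherianRing B]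

variable (k L N) in
/-- Injectivity of the Künneth map. With `0 → K → F → X → 0` exact and `F` finite free, the
component in bidegree `(0, n + 1)` is detected on `F`. The others come from degree `n` for `K` by
the connecting map, where they are known up to the image of `F`. -/
theorem kunnethSum_injective (n : ℕ) (X : ModuleCat.{u} A) [Module.Finite A X]
    (Y : ModuleCat.{u} B) [Module.Finite B Y]
    (t : ∀ i j : ℕ, Abelian.Ext X L i ⊗[k] Abelian.Ext Y N j) (ht : kunnethSum n t = 0)
    (i j : ℕ) (h : i + j = n) : t i j = 0 := by
  induction n generalizing X i j with
  | zero =>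
    obtain ⟨r, K, f, g, w, hK, hS⟩ := exists_shortExact_free_finite X
    have hg : Epi g := hS.epi_g
    obtain ⟨rfl, rfl⟩ : i = 0 ∧ j = 0 := by lia
    have h1 := extProductMap_rTensor (L := L) (Y := Y) (N := N) (zero_add 0) (zero_add 0)
      (Ext.mk₀ g) (t 0 0)
    rw [← kunnethSum_zero, ht, Ext.comp_zero] at h1
    have h2 := (injective_iff_map_eq_zero _).1
      (extProductMap_bijective_of_free k L N r 0 Y).1 _ h1
    exact (injective_iff_map_eq_zero _).1 (Module.Flat.rTensor_preserves_injective_linearMap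
      (M := Abelian.Ext Y N 0) ((Ext.mk₀ g).precompOfLinear k L (zero_add 0))
      (Ext.precomp_mk₀_injective_of_epi L g)) (t 0 0) h2
  | succ n ih =>
    obtain ⟨r, K, f, g, w, hK, hS⟩ := exists_shortExact_free_finite X
    have hg : Epi g := hS.epi_g
    have hP : Projective (ModuleCat.of A (Fin r → A)) :=
      ModuleCat.projective_of_free (Pi.basisFun A (Fin r))
    have h1 := kunnethSum_precomp (Ext.mk₀ g) (n + 1) t
    rw [ht, Ext.comp_zero, kunnethSum_of_projective] at h1
    have h2 := (injective_iff_map_eq_zero _).1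
      (extProductMap_bijective_of_free k L N r (n + 1) Y).1 _ h1
    have h3 : t 0 (n + 1) = 0 :=
      (injective_iff_map_eq_zero _).1 (Module.Flat.rTensor_preserves_injective_linearMap
        (M := Abelian.Ext Y N (n + 1)) ((Ext.mk₀ g).precompOfLinear k L (zero_add 0))
        (Ext.precomp_mk₀_injective_of_epi L g)) _ h2
    -- The components with positive first degree lift along the connecting map, as `Ext^(i+1)` of a
    -- free module vanishes.
    have hsurj (i j : ℕ) := LinearMap.rTensor_surjective (Abelian.Ext Y N j)
      (g := hS.extClass.precompOfLinear k L (add_comm 1 i)) (fun x =>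
        Ext.contravariant_sequence_exact₃ hS L x (Ext.eq_zero_of_projective _) (add_comm 1 i))
    choose t' ht' using fun i j => hsurj i j (t (i + 1) j)
    rw [kunnethSum_succ, h3, map_zero, zero_add] at ht
    simp only [← ht'] at ht
    rw [sum_extProductMap_precomp_one] at ht
    -- The lifts sum to the restriction of a class from the free module, which is a product of
    -- bidegree `(0, n)`; corrected by that restriction, they vanish by induction.
    obtain ⟨v, hv⟩ := extClassTensor_exact₁ hS Y _ _ ht
    obtain ⟨s, rfl⟩ := (extProductMap_bijective_of_free k L N r n Y).2 v
    obtain ⟨S, -, hS'⟩ := exists_kunnethSum_eq_extProductMap (zero_add n) s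
    have h4 := kunnethSum_precomp (Ext.mk₀ f) n S
    rw [hS'] at h4
    have h5 := kunnethSum_sub n t'
      (fun i j => ((Ext.mk₀ f).precompOfLinear k L (zero_add i)).rTensor _ (S i j))
    rw [h4, ← hv] at h5
    have h6 := ih K _ (h5.trans (sub_self _))
    obtain _ | i := i
    · obtain rfl : j = n + 1 := by lia
      exact h3
    · rw [← ht', sub_eq_zero.1 (h6 i j (by lia))]
      exact (Module.Flat.rTensor_exact (Abelian.Ext Y N j)
        (exact_precomp_f_precomp_extClass k hS L (add_comm 1 i)) _).2 ⟨_, rfl⟩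

/-- The external product is injective on each single summand of the Künneth formula. -/
theorem extProductMap_injective {i j n : ℕ} (h : i + j = n) [Module.Finite A X]
    [Module.Finite B Y] : Function.Injective (extProductMap k X L Y N i j n) := by
  rw [injective_iff_map_eq_zero]
  intro s hs
  obtain ⟨t, rfl, ht⟩ := exists_kunnethSum_eq_extProductMap h s
  exact kunnethSum_injective k L N n X Y t (ht.trans hs) i j h

/-- After pullback along a finite free cover of `X`, a class on `X ⊗ Y` agrees with the external
product of an element of bidegree `(0, n)` that is defined on `X` itself. -/
theorem exists_extProductMap_precomp_eq {n r : ℕ} {K : ModuleCat.{u} A}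
    {f : K ⟶ ModuleCat.of A (Fin r → A)} {g : ModuleCat.of A (Fin r → A) ⟶ X} {w : f ≫ g = 0}
    (hS : (ShortComplex.mk f g w).ShortExact) [Module.Finite A K] [Module.Finite B Y]
    (z : Abelian.Ext (extTensor k X Y) (extTensor k L N) n) :
    ∃ u : Abelian.Ext X L 0 ⊗[k] Abelian.Ext Y N n,
      (extClassTensor k (Ext.mk₀ g) Y).comp (z - extProductMap k X L Y N 0 n n u)
        (zero_add n) = 0 := by
  obtain ⟨s, hs⟩ := (extProductMap_bijective_of_free k L N r n Y).2
    ((extClassTensor k (Ext.mk₀ g) Y).comp z (zero_add n))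
  have h1 := extProductMap_rTensor (zero_add 0) (zero_add n) (Ext.mk₀ f) s
  rw [hs, ← Ext.comp_assoc _ _ _ (zero_add 0) (zero_add n) (by lia), ← extClassTensor_comp,
    Ext.mk₀_comp_mk₀, w, Ext.mk₀_zero, extClassTensor_zero, Ext.zero_comp] at h1
  have h2 := (injective_iff_map_eq_zero _).1 (extProductMap_injective (zero_add n)) _ h1
  -- `s` dies on `K` by injectivity of the external product there, hence descends to `X`.
  obtain ⟨u, rfl⟩ := (Module.Flat.rTensor_exact (Abelian.Ext Y N n)
    (exact_precomp_g_precomp_f k hS L 0) s).1 h2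
  refine ⟨u, ?_⟩
  have h3 := extProductMap_rTensor (Y := Y) (N := N) (j := n) (zero_add 0) (zero_add n)
    (Ext.mk₀ g) u
  rw [sub_eq_add_neg, Ext.comp_add, Ext.comp_neg, ← sub_eq_add_neg, sub_eq_zero]
  exact hs.symm.trans h3

variable (k L N) in
/-- Surjectivity of the Künneth map. After subtraction of a component in bidegree `(0, n)` the class
vanishes on a finite free cover of `X`, hence comes from a lower degree by the connecting map. -/
theorem kunnethSum_surjective (n : ℕ) (X : ModuleCat.{u} A) [Module.Finite A X]
    (Y : ModuleCat.{u} B) [Module.Finite B Y]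
    (z : Abelian.Ext (extTensor k X Y) (extTensor k L N) n) :
    ∃ t : ∀ i j : ℕ, Abelian.Ext X L i ⊗[k] Abelian.Ext Y N j, kunnethSum n t = z := by
  induction n generalizing X with
  | zero =>
    obtain ⟨r, K, f, g, w, hK, hS⟩ := exists_shortExact_free_finite X
    obtain ⟨u, hu⟩ := exists_extProductMap_precomp_eq hS z
    obtain ⟨t, -, ht⟩ := exists_kunnethSum_eq_extProductMap (zero_add 0) u
    refine ⟨t, (sub_eq_zero.1 (extClassTensor_injective hS Y _ ?_)).symm⟩
    rw [ht]
    exact hu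
  | succ n ih =>
    obtain ⟨r, K, f, g, w, hK, hS⟩ := exists_shortExact_free_finite X
    obtain ⟨u, hu⟩ := exists_extProductMap_precomp_eq hS z
    obtain ⟨y, hy⟩ := extClassTensor_exact₃ hS Y (add_comm 1 n) _ hu
    obtain ⟨t', rfl⟩ := ih K y
    refine ⟨fun i => match i with
      | 0 => Function.update 0 (n + 1) u
      | i + 1 => fun j => (hS.extClass.precompOfLinear k L (add_comm 1 i)).rTensor _ (t' i j), ?_⟩
    rw [kunnethSum_succ]
    simp only [Function.update_self]
    rw [sum_extProductMap_precomp_one, hy, add_sub_cancel]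

end Kunneth

/-! ### Surviving classes of a tensor product -/

section Towers

open CategoryTheory CategoryTheory.Limits CategoryTheory.Abelian ModuleCat

theorem TensorProduct.tmul_ne_zero_of_field {k V W : Type*} [Field k] [AddCommGroup V] [Module k V]
    [AddCommGroup W] [Module k W] {v : V} {w : W} (hv : v ≠ 0) (hw : w ≠ 0) :
    v ⊗ₜ[k] w ≠ 0 := by
  obtain ⟨φ, hφ⟩ : ∃ φ : Module.Dual k V, φ v ≠ 0 := by
    by_contra! h
    exact hv ((Module.forall_dual_apply_eq_zero_iff k v).1 h)
  obtain ⟨ψ, hψ⟩ : ∃ ψ : Module.Dual k W, ψ w ≠ 0 := by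
    by_contra! h
    exact hw ((Module.forall_dual_apply_eq_zero_iff k w).1 h)
  intro h
  have := congrArg (LinearMap.mul' k k ∘ₗ TensorProduct.map φ ψ) h
  simp [hφ, hψ] at this

section

variable {R : Type u} [CommRing R]

/-- For a decreasing family it suffices to test the stages `t ≥ s`, instead of all `t` with
`K t ≤ K s`. -/
theorem hasSurvivingClass_iff_of_antitone {K : ℕ → Ideal R} (hK : Antitone K)
    (M : ModuleCat.{u} R) (i : ℕ) :
    HasSurvivingClass K M i ↔
      ∃ (s : ℕ) (x : Abelian.Ext (ModuleCat.of R (R ⧸ K s)) M i), ∀ (t : ℕ) (h : s ≤ t),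
        (Abelian.Ext.mk₀ (quotientHom (hK h))).comp x (zero_add i) ≠ 0 := by
  refine ⟨fun ⟨s, x, hx⟩ => ⟨s, x, fun t h => hx t (hK h)⟩, fun ⟨s, x, hx⟩ =>
    ⟨s, x, fun t h h0 => hx (max s t) (le_max_left s t) ?_⟩⟩
  have := congrArg (fun z => (Abelian.Ext.mk₀ (quotientHom (hK (le_max_right s t)))).comp z
    (zero_add i)) h0
  simpa [Abelian.Ext.mk₀_comp_mk₀_assoc, quotientHom_comp] using this


/-- Isomorphic inverse systems of objects have the same surviving classes. -/
theorem exists_surviving_of_iso {X X' : ℕ → ModuleCat.{u} R} {p : ∀ {s t : ℕ}, s ≤ t → (X t ⟶ X s)}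
    {p' : ∀ {s t : ℕ}, s ≤ t → (X' t ⟶ X' s)} (e : ∀ s, X s ≅ X' s)
    (he : ∀ {s t : ℕ} (h : s ≤ t), p h ≫ (e s).hom = (e t).hom ≫ p' h) {Z : ModuleCat.{u} R} {n : ℕ}
    (hX : ∃ (s : ℕ) (x : Abelian.Ext (X s) Z n), ∀ (t : ℕ) (h : s ≤ t),
      (Ext.mk₀ (p h)).comp x (zero_add n) ≠ 0) :
    ∃ (s : ℕ) (x : Abelian.Ext (X' s) Z n), ∀ (t : ℕ) (h : s ≤ t),
      (Ext.mk₀ (p' h)).comp x (zero_add n) ≠ 0 := by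
  obtain ⟨s, x, hx⟩ := hX
  refine ⟨s, (Ext.mk₀ (e s).inv).comp x (zero_add n), fun t h h0 => hx t h ?_⟩
  have := congrArg (fun z => (Ext.mk₀ (e t).hom).comp z (zero_add n)) h0
  have hp : (e t).hom ≫ p' h ≫ (e s).inv = p h := by
    rw [← Category.assoc, ← he, Category.assoc, Iso.hom_inv_id, Category.comp_id]
  simpa [Ext.mk₀_comp_mk₀_assoc, hp] using this

end

variable {k A B : Type u} [Field k] [CommRing A] [Algebra k A] [CommRing B] [Algebra k B]

section

variable {X X' L : ModuleCat.{u} A} {Y Y' N : ModuleCat.{u} B}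

theorem extProductMap_map (i j n : ℕ) (f : X' ⟶ X) (g : Y' ⟶ Y)
    (t : Abelian.Ext X L i ⊗[k] Abelian.Ext Y N j) :
    extProductMap k X' L Y' N i j n
      (TensorProduct.map ((Ext.mk₀ f).precompOfLinear k L (zero_add i))
        ((Ext.mk₀ g).precompOfLinear k N (zero_add j)) t) =
      (Ext.mk₀ (extTensorMap k f g)).comp (extProductMap k X L Y N i j n t) (zero_add n) := by
  by_cases h : i + j = n
  · induction t using TensorProduct.induction_on with
    | zero => simp
    | tmul α β =>
      rw [TensorProduct.map_tmul, extProductMap_tmul h, extProductMap_tmul h]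
      refine (extProduct_precomp_left h (zero_add i) (zero_add n) h _ α _).trans ?_
      refine (congrArg (fun z => (extClassTensor k (Ext.mk₀ f) Y').comp z (zero_add n))
        (extProduct_precomp_right_of_hom (k := k) h g α β)).trans ?_
      rw [extClassTensor_mk₀, Ext.mk₀_comp_mk₀_assoc, extTensorMap_comp, Category.id_comp,
        Category.comp_id]
    | add s t hs ht => rw [map_add, map_add, map_add, hs, ht, Ext.comp_add]
  · rw [extProductMap_of_ne h, extProductMap_of_ne h]
    simp

theorem kunnethSum_map (n : ℕ) (f : X' ⟶ X) (g : Y' ⟶ Y)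
    (t : ∀ i j : ℕ, Abelian.Ext X L i ⊗[k] Abelian.Ext Y N j) :
    kunnethSum n (fun i j => TensorProduct.map ((Ext.mk₀ f).precompOfLinear k L (zero_add i))
        ((Ext.mk₀ g).precompOfLinear k N (zero_add j)) (t i j)) =
      (Ext.mk₀ (extTensorMap k f g)).comp (kunnethSum n t) (zero_add n) := by
  unfold kunnethSum
  simp only [extProductMap_map]
  exact (map_sum ((Ext.mk₀ (extTensorMap k f g)).precomp (extTensor k L N) (zero_add n)) _ _).symm

end

section

/-- The kernel of `A ⊗ B → P ⊗ Q` for cyclic modules `P = A ⧸ I` and `Q = B ⧸ J`. The modules `P`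
and `Q` are not required to be the quotients themselves, since the `k`-module structure of a
quotient need not be definitionally the one used for objects of `ModuleCat`. -/
theorem map_eq_zero_iff_mem_tensorSumIdeal {I : Ideal A} {J : Ideal B} {P Q : Type u}
    [AddCommGroup P] [Module A P] [Module k P] [IsScalarTower k A P]
    [AddCommGroup Q] [Module B Q] [Module k Q] [IsScalarTower k B Q]
    {p : A →ₗ[A] P} (hp : Function.Surjective p) (hI : LinearMap.ker p = I)
    {q : B →ₗ[B] Q} (hq : Function.Surjective q) (hJ : LinearMap.ker q = J) (r : A ⊗[k] B) :
    TensorProduct.map (p.restrictScalars k) (q.restrictScalars k) r = 0 ↔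
      r ∈ tensorSumIdeal (k := k) I J := by
  subst hI hJ
  set I := LinearMap.ker p
  set J := LinearMap.ker q
  have hker := Algebra.TensorProduct.map_ker (Ideal.Quotient.mkₐ k I) (Ideal.Quotient.mkₐ k J)
    (Ideal.Quotient.mkₐ_surjective k I) (Ideal.Quotient.mkₐ_surjective k J)
  have hmap (r : A ⊗[k] B) : TensorProduct.map (p.restrictScalars k) (q.restrictScalars k) r =
      TensorProduct.congr ((p.quotKerEquivOfSurjective hp).restrictScalars k)
        ((q.quotKerEquivOfSurjective hq).restrictScalars k)
        (Algebra.TensorProduct.map (Ideal.Quotient.mkₐ k I) (Ideal.Quotient.mkₐ k J) r) := by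
    induction r using TensorProduct.induction_on with
    | zero => simp
    | tmul a b => rfl
    | add r r' h h' => rw [map_add, map_add, map_add, h, h']
  rw [hmap, LinearEquiv.map_eq_zero_iff, tensorSumIdeal, Submodule.add_eq_sup]
  have hkI : RingHom.ker (Ideal.Quotient.mkₐ k I) = I := Ideal.mk_ker
  have hkJ : RingHom.ker (Ideal.Quotient.mkₐ k J) = J := Ideal.mk_ker
  rw [hkI, hkJ] at hker
  exact SetLike.ext_iff.1 hker r

variable (k) in
/-- The homomorphism from `A ⊗ B` to `A ⧸ I ⊗ B ⧸ J` that sends `1` to `1 ⊗ 1`. -/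
def toExtTensorQuotient (I : Ideal A) (J : Ideal B) : (A ⊗[k] B) →ₗ[A ⊗[k] B]
    extTensor k (ModuleCat.of A (A ⧸ I)) (ModuleCat.of B (B ⧸ J)) :=
  LinearMap.toSpanSingleton _ _ (extTmul k (X := ModuleCat.of A (A ⧸ I))
    (Y := ModuleCat.of B (B ⧸ J)) (Submodule.mkQ I 1) (Submodule.mkQ J 1))

theorem toExtTensorQuotient_tmul (I : Ideal A) (J : Ideal B) (a : A) (b : B) :
    toExtTensorQuotient k I J (a ⊗ₜ b) = extTmul k (X := ModuleCat.of A (A ⧸ I))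
      (Y := ModuleCat.of B (B ⧸ J)) (Submodule.mkQ I a) (Submodule.mkQ J b) := by
  refine (tmul_smul_extTmul a b _ _).trans ?_
  rw [← map_smul, ← map_smul, smul_eq_mul, mul_one, smul_eq_mul, mul_one]

theorem toExtTensorQuotient_surjective (I : Ideal A) (J : Ideal B) :
    Function.Surjective (toExtTensorQuotient k I J) := by
  intro t
  induction t using extTensor_induction with
  | zero => exact ⟨0, map_zero _⟩
  | tmul x y =>
    obtain ⟨a, rfl⟩ := Submodule.mkQ_surjective I x
    obtain ⟨b, rfl⟩ := Submodule.mkQ_surjective J y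
    exact ⟨a ⊗ₜ b, toExtTensorQuotient_tmul I J a b⟩
  | add s t hs ht =>
    obtain ⟨r, rfl⟩ := hs
    obtain ⟨r', rfl⟩ := ht
    exact ⟨r + r', map_add _ _ _⟩

theorem smul_extTmul_eq_map {X : ModuleCat.{u} A} {Y : ModuleCat.{u} B} (x : X) (y : Y)
    (r : A ⊗[k] B) : r • extTmul k x y =
      TensorProduct.map ((LinearMap.toSpanSingleton A X x).restrictScalars k)
        ((LinearMap.toSpanSingleton B Y y).restrictScalars k) r := by
  induction r using TensorProduct.induction_on with
  | zero => exact zero_smul _ _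
  | tmul a b => exact tmul_smul_extTmul a b x y
  | add r r' h h' => rw [add_smul, map_add, h, h']; rfl

theorem smul_extTmul_eq_zero_iff {X : ModuleCat.{u} A} {Y : ModuleCat.{u} B} {x : X} {y : Y}
    (hx : Function.Surjective (LinearMap.toSpanSingleton A X x))
    (hy : Function.Surjective (LinearMap.toSpanSingleton B Y y))
    (r : A ⊗[k] B) : r • extTmul k x y = 0 ↔
      r ∈ tensorSumIdeal (k := k) (LinearMap.ker (LinearMap.toSpanSingleton A X x))
        (LinearMap.ker (LinearMap.toSpanSingleton B Y y)) := by
  rw [smul_extTmul_eq_map]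
  exact map_eq_zero_iff_mem_tensorSumIdeal hx rfl hy rfl r

theorem ker_toExtTensorQuotient (I : Ideal A) (J : Ideal B) :
    LinearMap.ker (toExtTensorQuotient k I J) = tensorSumIdeal (k := k) I J := by
  have hI : LinearMap.toSpanSingleton A (A ⧸ I) (Submodule.mkQ I 1) = Submodule.mkQ I := by
    ext; simp
  have hJ : LinearMap.toSpanSingleton B (B ⧸ J) (Submodule.mkQ J 1) = Submodule.mkQ J := by
    ext; simp
  ext r
  have hsI : Function.Surjective (LinearMap.toSpanSingleton A (A ⧸ I) (Submodule.mkQ I 1)) := by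
    rw [hI]
    exact Submodule.mkQ_surjective I
  have hsJ : Function.Surjective (LinearMap.toSpanSingleton B (B ⧸ J) (Submodule.mkQ J 1)) := by
    rw [hJ]
    exact Submodule.mkQ_surjective J
  have := smul_extTmul_eq_zero_iff (k := k) (X := ModuleCat.of A (A ⧸ I))
    (Y := ModuleCat.of B (B ⧸ J)) (x := Submodule.mkQ I 1) (y := Submodule.mkQ J 1)
    hsI hsJ r
  refine this.trans ?_
  rw [show LinearMap.ker (LinearMap.toSpanSingleton A (ModuleCat.of A (A ⧸ I))
      (Submodule.mkQ I 1)) = I from (congrArg LinearMap.ker hI).trans (Submodule.ker_mkQ I),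
    show LinearMap.ker (LinearMap.toSpanSingleton B (ModuleCat.of B (B ⧸ J))
      (Submodule.mkQ J 1)) = J from (congrArg LinearMap.ker hJ).trans (Submodule.ker_mkQ J)]

variable (k) in
/-- The canonical isomorphism from `(A ⊗ B) ⧸ (I ⊗ B + A ⊗ J)` to `A ⧸ I ⊗ B ⧸ J`. -/
def quotientIsoExtTensor (I : Ideal A) (J : Ideal B) :
    ModuleCat.of (A ⊗[k] B) ((A ⊗[k] B) ⧸ tensorSumIdeal (k := k) I J) ≅
      extTensor k (ModuleCat.of A (A ⧸ I)) (ModuleCat.of B (B ⧸ J)) :=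
  ((Submodule.quotEquivOfEq _ _ (ker_toExtTensorQuotient I J).symm).trans
    ((toExtTensorQuotient k I J).quotKerEquivOfSurjective
      (toExtTensorQuotient_surjective I J))).toModuleIso

theorem quotientIsoExtTensor_hom_naturality {I I' : Ideal A} {J J' : Ideal B} (hI : I ≤ I')
    (hJ : J ≤ J') (h : tensorSumIdeal (k := k) I J ≤ tensorSumIdeal (k := k) I' J') :
    quotientHom h ≫ (quotientIsoExtTensor k I' J').hom =
      (quotientIsoExtTensor k I J).hom ≫ extTensorMap k (quotientHom hI) (quotientHom hJ) := by
  refine ModuleCat.hom_ext (LinearMap.ext fun r => ?_)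
  obtain ⟨r, rfl⟩ := Submodule.mkQ_surjective _ r
  change toExtTensorQuotient k I' J' r = extTensorMap k (quotientHom hI) (quotientHom hJ)
    (toExtTensorQuotient k I J r)
  simp only [toExtTensorQuotient, LinearMap.toSpanSingleton_apply]
  rw [map_smul]
  rfl

theorem tensorSumIdeal_mono {I I' : Ideal A} {J J' : Ideal B} (hI : I ≤ I') (hJ : J ≤ J') :
    tensorSumIdeal (k := k) I J ≤ tensorSumIdeal (k := k) I' J' :=
  sup_le_sup (Ideal.map_mono hI) (Ideal.map_mono hJ)

theorem tensorSumIdeal_pow_le_pow (I : Ideal A) (J : Ideal B) (s : ℕ) :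
    tensorSumIdeal (k := k) (I ^ s) (J ^ s) ≤ tensorSumIdeal (k := k) I J ^ s := by
  unfold tensorSumIdeal
  rw [Ideal.map_pow, Ideal.map_pow]
  exact sup_le (Ideal.pow_right_mono le_sup_left s) (Ideal.pow_right_mono le_sup_right s)

theorem pow_le_tensorSumIdeal_pow (I : Ideal A) (J : Ideal B) (s : ℕ) :
    tensorSumIdeal (k := k) I J ^ (s + s) ≤ tensorSumIdeal (k := k) (I ^ s) (J ^ s) := by
  unfold tensorSumIdeal
  rw [Ideal.map_pow, Ideal.map_pow]
  exact Ideal.sup_pow_add_le_pow_sup_pow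

end

section

variable {L : ModuleCat.{u} A} {N : ModuleCat.{u} B} {I : ℕ → Ideal A} {J : ℕ → Ideal B}

/-- Surviving classes for the quotients of `A ⊗ B` by `I s ⊗ B + A ⊗ J s`, in terms of the external
tensor products of the quotients of `A` and `B`. -/
theorem hasSurvivingClass_tensorSumIdeal_iff (hI : Antitone I) (hJ : Antitone J)
    (Z : ModuleCat.{u} (A ⊗[k] B)) (n : ℕ) :
    HasSurvivingClass (fun s => tensorSumIdeal (k := k) (I s) (J s)) Z n ↔
      ∃ (s : ℕ) (x : Abelian.Ext (extTensor k (ModuleCat.of A (A ⧸ I s))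
        (ModuleCat.of B (B ⧸ J s))) Z n), ∀ (t : ℕ) (h : s ≤ t),
        (Ext.mk₀ (extTensorMap k (quotientHom (hI h)) (quotientHom (hJ h)))).comp x
          (zero_add n) ≠ 0 := by
  have hK : Antitone (fun s => tensorSumIdeal (k := k) (I s) (J s)) :=
    fun _ _ h => tensorSumIdeal_mono (hI h) (hJ h)
  rw [hasSurvivingClass_iff_of_antitone hK]
  exact ⟨exists_surviving_of_iso (fun s => quotientIsoExtTensor k (I s) (J s))
      fun h => quotientIsoExtTensor_hom_naturality (hI h) (hJ h) (hK h),
    exists_surviving_of_iso (fun s => (quotientIsoExtTensor k (I s) (J s)).symm)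
      fun h => by
        rw [Iso.symm_hom, Iso.symm_hom, Iso.eq_inv_comp, ← Category.assoc,
          ← quotientIsoExtTensor_hom_naturality (hI h) (hJ h) (hK h), Category.assoc,
          Iso.hom_inv_id, Category.comp_id]⟩

/-- If one of the two families has no surviving class, then every element of the tensor product of
the `Ext` groups dies at some stage, because each of its finitely many pure tensors does. -/
theorem exists_map_eq_zero (hI : Antitone I) (hJ : Antitone J) {i j : ℕ}
    (h : ¬ (HasSurvivingClass I L i ∧ HasSurvivingClass J N j)) (s : ℕ)
    (x : Abelian.Ext (ModuleCat.of A (A ⧸ I s)) L i ⊗[k]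
      Abelian.Ext (ModuleCat.of B (B ⧸ J s)) N j) :
    ∃ t, ∃ ht : s ≤ t, ∀ t' (ht' : t ≤ t'), TensorProduct.map
      ((Ext.mk₀ (quotientHom (hI (ht.trans ht')))).precompOfLinear k L (zero_add i))
      ((Ext.mk₀ (quotientHom (hJ (ht.trans ht')))).precompOfLinear k N (zero_add j)) x = 0 := by
  rw [hasSurvivingClass_iff_of_antitone hI, hasSurvivingClass_iff_of_antitone hJ] at h
  induction x using TensorProduct.induction_on with
  | zero => exact ⟨s, le_rfl, fun _ _ => map_zero _⟩
  | tmul x y =>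
    rw [not_and_or] at h
    push Not at h
    obtain h | h := h
    · obtain ⟨t, ht, h0⟩ := h s x
      refine ⟨t, ht, fun t' ht' => ?_⟩
      have := congrArg (fun z => (Ext.mk₀ (quotientHom (hI ht'))).comp z (zero_add i)) h0
      simp only [Ext.mk₀_comp_mk₀_assoc, quotientHom_comp, Ext.comp_zero] at this
      rw [TensorProduct.map_tmul]
      exact (congrArg (· ⊗ₜ[k] _) this).trans (TensorProduct.zero_tmul _ _)
    · obtain ⟨t, ht, h0⟩ := h s y
      refine ⟨t, ht, fun t' ht' => ?_⟩
      have := congrArg (fun z => (Ext.mk₀ (quotientHom (hJ ht'))).comp z (zero_add j)) h0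
      simp only [Ext.mk₀_comp_mk₀_assoc, quotientHom_comp, Ext.comp_zero] at this
      rw [TensorProduct.map_tmul]
      exact (congrArg (_ ⊗ₜ[k] ·) this).trans (TensorProduct.tmul_zero _ _)
  | add x y hx hy =>
    obtain ⟨t, ht, hx⟩ := hx
    obtain ⟨t', ht', hy⟩ := hy
    refine ⟨max t t', ht.trans (le_max_left t t'), fun r hr => ?_⟩
    rw [map_add, hx r ((le_max_left t t').trans hr), hy r ((le_max_right t t').trans hr), add_zero]

variable [IsNoetherianRing A] [IsNoetherianRing B]

/-- The external product of two surviving classes survives. -/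
theorem HasSurvivingClass.tensorSumIdeal (hI : Antitone I) (hJ : Antitone J) {i j n : ℕ}
    (hn : i + j = n) (hL : HasSurvivingClass I L i) (hN : HasSurvivingClass J N j) :
    HasSurvivingClass (fun s => tensorSumIdeal (k := k) (I s) (J s)) (extTensor k L N) n := by
  rw [hasSurvivingClass_iff_of_antitone hI] at hL
  rw [hasSurvivingClass_iff_of_antitone hJ] at hN
  rw [hasSurvivingClass_tensorSumIdeal_iff hI hJ]
  obtain ⟨s, x, hx⟩ := hL
  obtain ⟨s', y, hy⟩ := hN
  refine ⟨max s s', extProduct k hn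
    ((Ext.mk₀ (quotientHom (hI (le_max_left s s')))).comp x (zero_add i))
    ((Ext.mk₀ (quotientHom (hJ (le_max_right s s')))).comp y (zero_add j)), fun t h h0 => ?_⟩
  rw [← extProductMap_tmul, ← extProductMap_map] at h0
  have h1 := (injective_iff_map_eq_zero _).1 (extProductMap_injective hn) _ h0
  rw [TensorProduct.map_tmul] at h1
  refine TensorProduct.tmul_ne_zero_of_field (?_) (?_) h1
  · have := hx t ((le_max_left s s').trans h)
    rwa [← quotientHom_comp (hI h), ← Ext.mk₀_comp_mk₀_assoc] at this
  · have := hy t ((le_max_right s s').trans h)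
    rwa [← quotientHom_comp (hJ h), ← Ext.mk₀_comp_mk₀_assoc] at this

/-- A surviving class for the tensor product has a Künneth component in a bidegree where both
factors have surviving classes; otherwise each of its finitely many components would die. -/
theorem HasSurvivingClass.of_tensorSumIdeal (hI : Antitone I) (hJ : Antitone J) {n : ℕ}
    (h : HasSurvivingClass (fun s => _root_.tensorSumIdeal (k := k) (I s) (J s))
      (extTensor k L N) n) :
    ∃ i j, i + j = n ∧ HasSurvivingClass I L i ∧ HasSurvivingClass J N j := by
  rw [hasSurvivingClass_tensorSumIdeal_iff hI hJ] at h
  obtain ⟨s, x, hx⟩ := h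
  obtain ⟨t, rfl⟩ := kunnethSum_surjective k L N n _ _ x
  by_contra! h
  -- Each component dies at a stage `T p`; the sum of these dominates them all.
  have h' (p : ℕ × ℕ) (hp : p ∈ Finset.HasAntidiagonal.antidiagonal n) :=
    exists_map_eq_zero (k := k) hI hJ (fun hp' =>
      h p.1 p.2 (Finset.HasAntidiagonal.mem_antidiagonal.1 hp) hp'.1 hp'.2) s (t p.1 p.2)
  choose! T hT hT' using h'
  have hs : s ≤ s + ∑ p ∈ Finset.HasAntidiagonal.antidiagonal n, T p := le_self_add
  refine hx _ hs ?_
  rw [← kunnethSum_map, kunnethSum]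
  refine Finset.sum_eq_zero fun p hp => ?_
  rw [hT' p hp _ ((Finset.single_le_sum (fun _ _ => Nat.zero_le _) hp).trans le_add_self),
    map_zero]

end

end Towers

/-! ### Supports of local cohomology and the Cohen-Macaulay property -/

section CohenMacaulay

open CategoryTheory CategoryTheory.Abelian ModuleCat
open scoped Pointwise

/-- The empty set is excluded, as its infimum is `⊤` and its supremum is `⊥`. -/
theorem iInf_eq_iSup_natCast_iff (S : Set ℕ) :
    (⨅ i ∈ S, ((i : ℕ∞) : WithBot ℕ∞)) = (⨆ i ∈ S, ((i : ℕ∞) : WithBot ℕ∞)) ↔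
      ∃ d, S = {d} := by
  constructor
  · intro h
    have hle (i : ℕ) (hi : i ∈ S) (j : ℕ) (hj : j ∈ S) : i ≤ j := by
      have h1 : ((i : ℕ∞) : WithBot ℕ∞) ≤ ((j : ℕ∞) : WithBot ℕ∞) :=
        (le_iSup₂ (f := fun (i : ℕ) (_ : i ∈ S) => ((i : ℕ∞) : WithBot ℕ∞)) i hi).trans
          (h.symm.le.trans
            (iInf₂_le (f := fun (i : ℕ) (_ : i ∈ S) => ((i : ℕ∞) : WithBot ℕ∞)) j hj))
      exact_mod_cast h1
    obtain rfl | ⟨d, hd⟩ := S.eq_empty_or_nonempty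
    · simp at h
    · exact ⟨d, Set.eq_singleton_iff_unique_mem.2
        ⟨hd, fun i hi => le_antisymm (hle i hi d hd) (hle d hd i hi)⟩⟩
  · rintro ⟨d, rfl⟩
    simp

theorem isCohenMacaulayWrt_iff {R : Type u} [CommRing R] {𝔞 : Ideal R} {M : Type u}
    [AddCommGroup M] [Module R M] (h : 𝔞 • (⊤ : Submodule R M) ≠ ⊤) :
    IsCohenMacaulayWrt 𝔞 M ↔ ∃ d, localCohomologySupport 𝔞 M = {d} := by
  rw [← iInf_eq_iSup_natCast_iff]
  exact ⟨fun h' => (h'.resolve_left h).2, fun h' => Or.inr ⟨h, h'⟩⟩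

theorem Set.exists_add_eq_singleton_iff (S T : Set ℕ) :
    (∃ d, S + T = {d}) ↔ (∃ d, S = {d}) ∧ ∃ d, T = {d} := by
  constructor
  · rintro ⟨d, hd⟩
    have hne : (S + T).Nonempty := hd ▸ Set.singleton_nonempty d
    obtain ⟨_, i, hi, j, hj, -⟩ := hne
    have hadd (i' j' : ℕ) (hi' : i' ∈ S) (hj' : j' ∈ T) : i' + j' = d :=
      hd.subset (Set.add_mem_add hi' hj')
    refine ⟨⟨i, Set.eq_singleton_iff_unique_mem.2 ⟨hi, fun i' hi' => ?_⟩⟩,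
      ⟨j, Set.eq_singleton_iff_unique_mem.2 ⟨hj, fun j' hj' => ?_⟩⟩⟩
    · have := hadd i j hi hj
      have := hadd i' j hi' hj
      lia
    · have := hadd i j hi hj
      have := hadd i j' hi hj'
      lia
  · rintro ⟨⟨d, rfl⟩, ⟨e, rfl⟩⟩
    exact ⟨d + e, Set.singleton_add_singleton⟩

variable {k A B : Type u} [Field k] [CommRing A] [Algebra k A] [CommRing B] [Algebra k B]

/-- If `I` annihilates `X` and `J` annihilates `Y`, then `I ⊗ B + A ⊗ J` annihilates `X ⊗ Y`. -/
theorem tensorSumIdeal_smul_extTensor {I : Ideal A} {J : Ideal B} {X : ModuleCat.{u} A}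
    {Y : ModuleCat.{u} B} (hI : ∀ a ∈ I, ∀ x : X, a • x = 0) (hJ : ∀ b ∈ J, ∀ y : Y, b • y = 0)
    {r : A ⊗[k] B} (hr : r ∈ tensorSumIdeal (k := k) I J) (t : extTensor k X Y) : r • t = 0 := by
  have h : tensorSumIdeal (k := k) I J ≤ Module.annihilator (A ⊗[k] B) (extTensor k X Y) := by
    refine sup_le (Ideal.map_le_iff_le_comap.2 fun a ha => ?_)
      (Ideal.map_le_iff_le_comap.2 fun b hb => ?_)
    · refine Module.mem_annihilator.2 fun t => ?_
      induction t using extTensor_induction with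
      | zero => exact smul_zero _
      | tmul x y =>
        refine (tmul_smul_extTmul a 1 x y).trans ?_
        rw [hI a ha]
        exact TensorProduct.zero_tmul _ _
      | add s t hs ht => rw [smul_add, hs, ht, add_zero]
    · refine Module.mem_annihilator.2 fun t => ?_
      induction t using extTensor_induction with
      | zero => exact smul_zero _
      | tmul x y =>
        refine (tmul_smul_extTmul 1 b x y).trans ?_
        rw [hJ b hb]
        exact TensorProduct.tmul_zero _ _
      | add s t hs ht => rw [smul_add, hs, ht, add_zero]
  exact Module.mem_annihilator.1 (h hr) t

/-- The external tensor product surjects onto `L / I L ⊗ N / J N`, which is nonzero over a field. -/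
theorem tensorSumIdeal_smul_top_ne_top {I : Ideal A} {J : Ideal B} {L : ModuleCat.{u} A}
    {N : ModuleCat.{u} B} (hI : I • (⊤ : Submodule A L) ≠ ⊤) (hJ : J • (⊤ : Submodule B N) ≠ ⊤) :
    tensorSumIdeal (k := k) I J • (⊤ : Submodule (A ⊗[k] B) (extTensor k L N)) ≠ ⊤ := by
  obtain ⟨x, hx⟩ : ∃ x, x ∉ I • (⊤ : Submodule A L) := by
    by_contra! h
    exact hI (Submodule.eq_top_iff'.2 h)
  obtain ⟨y, hy⟩ : ∃ y, y ∉ J • (⊤ : Submodule B N) := by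
    by_contra! h
    exact hJ (Submodule.eq_top_iff'.2 h)
  intro h
  let p : L ⟶ ModuleCat.of A (L ⧸ I • (⊤ : Submodule A L)) := ModuleCat.ofHom (Submodule.mkQ _)
  let q : N ⟶ ModuleCat.of B (N ⧸ J • (⊤ : Submodule B N)) := ModuleCat.ofHom (Submodule.mkQ _)
  have hle : tensorSumIdeal (k := k) I J • (⊤ : Submodule (A ⊗[k] B) (extTensor k L N)) ≤
      LinearMap.ker (extTensorMap k p q).hom := by
    refine Submodule.smul_le.2 fun r hr t _ => ?_
    rw [LinearMap.mem_ker, map_smul]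
    refine tensorSumIdeal_smul_extTensor (fun a ha x => ?_) (fun b hb y => ?_) hr _
    · obtain ⟨x, rfl⟩ := Submodule.mkQ_surjective _ x
      exact (Submodule.Quotient.mk_eq_zero _).2 (Submodule.smul_mem_smul ha trivial)
    · obtain ⟨y, rfl⟩ := Submodule.mkQ_surjective _ y
      exact (Submodule.Quotient.mk_eq_zero _).2 (Submodule.smul_mem_smul hb trivial)
  have h0 : extTensorMap k p q (extTmul k x y) = 0 := by
    have := h.ge (Submodule.mem_top (x := extTmul k x y))
    exact hle this
  exact TensorProduct.tmul_ne_zero_of_field (v := p x) (w := q y)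
    (fun h => hx ((Submodule.Quotient.mk_eq_zero _).1 h))
    (fun h => hy ((Submodule.Quotient.mk_eq_zero _).1 h)) h0

/-- A module over a `k`-algebra carries at most one compatible `k`-module structure. -/
theorem Module.eq_restrictScalars {M : Type*} [AddCommGroup M] [Module A M] [m : Module k M]
    [IsScalarTower k A M] : m = Module.restrictScalars k A M :=
  Module.ext' _ _ fun c x => (algebraMap_smul A c x).symm

variable [IsNoetherianRing A] [IsNoetherianRing B]

/-- The degrees in which the local cohomology of `L ⊗ N` is nonzero are the sums of those for `L`
and for `N`. -/
theorem localCohomologySupport_extTensor (I : Ideal A) (J : Ideal B) (L : ModuleCat.{u} A)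
    (N : ModuleCat.{u} B) :
    localCohomologySupport (tensorSumIdeal (k := k) I J) (extTensor k L N) =
      localCohomologySupport I L + localCohomologySupport J N := by
  have hI : Antitone (I ^ ·) := fun _ _ h => Ideal.pow_le_pow_right h
  have hJ : Antitone (J ^ ·) := fun _ _ h => Ideal.pow_le_pow_right h
  have h₁ (s : ℕ) :
      ∃ t, tensorSumIdeal (k := k) I J ^ t ≤ tensorSumIdeal (k := k) (I ^ s) (J ^ s) :=
    ⟨_, pow_le_tensorSumIdeal_pow I J s⟩
  have h₂ (s : ℕ) :
      ∃ t, tensorSumIdeal (k := k) (I ^ t) (J ^ t) ≤ tensorSumIdeal (k := k) I J ^ s :=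
    ⟨s, tensorSumIdeal_pow_le_pow I J s⟩
  ext n
  rw [mem_localCohomologySupport_iff, Set.mem_add]
  constructor
  · intro h
    obtain ⟨i, j, hn, hi, hj⟩ := (h.of_cofinal h₂ h₁).of_tensorSumIdeal hI hJ
    exact ⟨i, (mem_localCohomologySupport_iff I i L).2 hi, j,
      (mem_localCohomologySupport_iff J j N).2 hj, hn⟩
  · rintro ⟨i, hi, j, hj, hn⟩
    rw [mem_localCohomologySupport_iff] at hi hj
    exact (hi.tensorSumIdeal hI hJ hn hj).of_cofinal h₁ h₂

theorem isCohenMacaulayWrt_extTensor_iff {I : Ideal A} {J : Ideal B} {L : ModuleCat.{u} A}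
    {N : ModuleCat.{u} B} (hI : I • (⊤ : Submodule A L) ≠ ⊤) (hJ : J • (⊤ : Submodule B N) ≠ ⊤) :
    IsCohenMacaulayWrt (tensorSumIdeal (k := k) I J) (extTensor k L N) ↔
      IsCohenMacaulayWrt I L ∧ IsCohenMacaulayWrt J N := by
  rw [isCohenMacaulayWrt_iff (tensorSumIdeal_smul_top_ne_top hI hJ), isCohenMacaulayWrt_iff hI,
    isCohenMacaulayWrt_iff hJ, localCohomologySupport_extTensor, Set.exists_add_eq_singleton_iff]

end CohenMacaulay

theorem corollary2p7 (k A B L N : Type u) [Field k]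
    [CommRing A] [Algebra k A] [IsNoetherianRing A]
    [CommRing B] [Algebra k B] [IsNoetherianRing B]
    [IsNoetherianRing (A ⊗[k] B)]
    [AddCommGroup L] [Module k L] [Module A L] [IsScalarTower k A L] [Module.Finite A L]
    [AddCommGroup N] [Module k N] [Module B N] [IsScalarTower k B N] [Module.Finite B N]
    (I : Ideal A) (J : Ideal B)
    (hI : I • (⊤ : Submodule A L) ≠ ⊤) (hJ : J • (⊤ : Submodule B N) ≠ ⊤) :
    letI : Module (A ⊗[k] B) (L ⊗[k] N) := tensorModule k A B L N
    IsCohenMacaulayWrt (tensorSumIdeal (k := k) I J) (L ⊗[k] N) ↔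
      IsCohenMacaulayWrt I L ∧ IsCohenMacaulayWrt J N := by
  -- Objects of `ModuleCat` over a `k`-algebra carry the restricted `k`-module structure; the given
  -- one is equal to it, though not by definition.
  obtain rfl : ‹Module k L› = Module.restrictScalars k A L := Module.eq_restrictScalars
  obtain rfl : ‹Module k N› = Module.restrictScalars k B N := Module.eq_restrictScalars
  exact isCohenMacaulayWrt_extTensor_iff (L := ModuleCat.of A L) (N := ModuleCat.of B N) hI hJ

end
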